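/- Let $\mathcal{C}$ be a proto-abelian category: $\mathcal{C}$ has a zero object; every diagram $A' \twoheadleftarrow A \hookrightarrow B$ (an epimorphism and a monomorphism) can be completed to a pushout square, and every diagram $A' \hookrightarrow B' \twoheadleftarrow B$ can be completed to a pullback square, of the form $$\begin{array}{ccc} A & \hookrightarrow & B\\ \downarrow & & \downarrow\\ A' & \hookrightarrow & B'\end{array}$$ with horizontal monomorphisms and vertical epimorphisms; and a commutative square of this form is a pushout square if and only if it is a pullback square (it is then called biCartesian). Fix a zero object $0$ of $\mathcal{C}$. For $n \ge 0$ let $\mathcal{S}_n$ be the groupoid of flags of length $n$, i.e. the maximal groupoid in the category of commutative triangular diagrams $(A_{i,j})_{0 \le i \le j \le n}$ in $\mathcal{C}$ with $A_{i,i} = 0$, all horizontal maps $A_{i,j} \hookrightarrow A_{i,k}$ monomorphisms, all vertical maps $A_{i,k} \twoheadrightarrow A_{j,k}$ epimorphisms and all squares biCartesian. For a subset $I \subset \{0,\dots,n\}$ write $\mathcal{S}_n \to \mathcal{S}_I$ for the restriction of a diagram to the rows and columns with index in $I$, where $\mathcal{S}_I$ is identified with $\mathcal{S}_{|I|-1}$.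 Let $\mathrm{Span}(\mathbf{Grpd})$ be the category whose objects are groupoids and whose morphisms $\mathcal{A} \to \mathcal{B}$ are spans $\mathcal{A} \leftarrow \mathcal{X} \to \mathcal{B}$ of groupoids, modulo equivalences $\mathcal{X} \simeq \mathcal{X}'$ compatible with both legs up to natural isomorphism; composition is given by $2$-pullback. It is a monoidal category with tensor product the product of groupoids and of spans and with unit the terminal groupoid. Then the canonical span $1 \leftarrow \mathcal{S}_0 \xrightarrow{\mathrm{id}} \mathcal{S}_0$ identifies $\mathcal{S}_0$ with the monoidal unit $1$ of $\mathrm{Span}(\mathbf{Grpd})$, and the morphisms $\mu : \mathcal{S}_1 \otimes \mathcal{S}_1 \to \mathcal{S}_1$ and $e : 1 \cong \mathcal{S}_0 \to \mathcal{S}_1$ represented by the spans $$\mathcal{S}_{\{0,1\}} \times \mathcal{S}_{\{1,2\}} \longleftarrow \mathcal{S}_{\{0,1,2\}} \longrightarrow \mathcal{S}_{\{0,2\}}, \qquad \mathcal{S}_0 \xleftarrow{\ \mathrm{id}\ } \mathcal{S}_0 \xrightarrow{\ 0 \mapsto 0\ } \mathcal{S}_1$$ make $\mathcal{S}_1$ an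 associative unital algebra object (a monoid object) in $\mathrm{Span}(\mathbf{Grpd})$, called the abstract Hall algebra of $\mathcal{C}$. -/

import Mathlib

open CategoryTheory CategoryTheory.Limits
open scoped CategoryTheory.Prod
universe v u

namespace TwoPullback

/-- The 2-pullback of groupoids, with objects the triples `(x, y, F x ≅ G y)`, is a groupoid. -/
instance groupoid {X Y B : Type*} [Groupoid X] [Groupoid Y] [Groupoid B]
    (F : X ⥤ B) (G : Y ⥤ B) : Groupoid (CategoricalPullback F G) where
  inv f := ⟨Groupoid.inv f.fst, Groupoid.inv f.snd, by
    have := f.w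
    simp only [Groupoid.inv_eq_inv, Functor.map_inv, IsIso.inv_comp_eq]
    rw [← Category.assoc, this]; simp⟩
  inv_comp f := by ext <;> simp
  comp_inv f := by ext <;> simp

universe w
variable {X Y Z B C X' Y' B' : Type w} [Category.{v} X] [Category.{v} Y] [Category.{v} Z]
  [Category.{v} B] [Category.{v} C] [Category.{v} X'] [Category.{v} Y'] [Category.{v} B']

section
variable {R : X ⥤ B} {L : Y ⥤ B} {R' : X' ⥤ B} {L' : Y' ⥤ B}

/-- The functor between 2-pullbacks induced by functors compatible with the cospans. -/
@[simps]
def map (F : X ⥤ X') (G : Y ⥤ Y') (r : F ⋙ R' ≅ R) (l : G ⋙ L' ≅ L) :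
    CategoricalPullback R L ⥤ CategoricalPullback R' L' where
  obj x := ⟨F.obj x.fst, G.obj x.snd, r.app _ ≪≫ x.iso ≪≫ (l.app _).symm⟩
  map f := ⟨F.map f.fst, G.map f.snd, by
    have h1 := r.hom.naturality f.fst
    have h2 := l.inv.naturality f.snd
    have := f.w
    simp only [Functor.comp_map, Iso.trans_hom, Iso.symm_hom, Iso.app_hom, Iso.app_inv,
      Category.assoc] at h1 h2 ⊢
    rw [reassoc_of% h1, reassoc_of% this, h2]⟩

theorem map_isEquivalence (F : X ⥤ X') (G : Y ⥤ Y') (r : F ⋙ R' ≅ R) (l : G ⋙ L' ≅ L)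
    [F.IsEquivalence] [G.IsEquivalence] : (map F G r l).IsEquivalence where
  faithful := ⟨fun {x y f g} h => by
    ext
    · exact F.map_injective (congrArg CategoricalPullback.Hom.fst h)
    · exact G.map_injective (congrArg CategoricalPullback.Hom.snd h)⟩
  full := ⟨fun {x y} f => by
    obtain ⟨p, q, w⟩ := f
    obtain ⟨f₁, rfl⟩ := F.map_surjective p
    obtain ⟨f₂, rfl⟩ := G.map_surjective q
    have h1 : R'.map (F.map f₁) ≫ r.hom.app y.fst = r.hom.app x.fst ≫ R.map f₁ :=
      r.hom.naturality f₁
    have h2 : L.map f₂ ≫ l.inv.app y.snd = l.inv.app x.snd ≫ L'.map (G.map f₂) :=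
      l.inv.naturality f₂
    have h3 : R'.map (F.map f₁) ≫ r.hom.app y.fst ≫ y.iso.hom ≫ l.inv.app y.snd =
      (r.hom.app x.fst ≫ x.iso.hom ≫ l.inv.app x.snd) ≫ L'.map (G.map f₂) := w
    rw [reassoc_of% h1, Category.assoc, Category.assoc, ← h2, cancel_epi] at h3
    refine ⟨⟨f₁, f₂, ?_⟩, rfl⟩
    rw [← cancel_mono (l.inv.app y.snd), Category.assoc, Category.assoc, h3]⟩
  essSurj := ⟨fun y => by
    refine ⟨⟨F.objPreimage y.fst, G.objPreimage y.snd,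
      (r.app _).symm ≪≫ R'.mapIso (F.objObjPreimageIso _) ≪≫ y.iso ≪≫
        L'.mapIso (G.objObjPreimageIso _).symm ≪≫ l.app _⟩, ⟨?_⟩⟩
    refine CategoricalPullback.mkIso (F.objObjPreimageIso _) (G.objObjPreimageIso _) ?_
    change R'.map (F.objObjPreimageIso y.fst).hom ≫ y.iso.hom =
      (r.hom.app _ ≫ (r.inv.app _ ≫ R'.map (F.objObjPreimageIso y.fst).hom ≫ y.iso.hom ≫
        L'.map (G.objObjPreimageIso y.snd).inv ≫ l.hom.app _) ≫ l.inv.app _) ≫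
      L'.map (G.objObjPreimageIso y.snd).hom
    simp [← Functor.map_comp]⟩
end

/-- The 2-pullback along an identity functor on the left. -/
def idLeft (L : Y ⥤ B) : CategoricalPullback (𝟭 B) L ≌ Y where
  functor := CategoricalPullback.π₂ _ _
  inverse :=
    { obj x := ⟨L.obj x, x, Iso.refl _⟩
      map f := ⟨L.map f, f, by simp⟩ }
  unitIso := NatIso.ofComponents
    (fun x => CategoricalPullback.mkIso x.iso (Iso.refl _) (by
      change x.iso.hom ≫ 𝟙 _ = x.iso.hom ≫ L.map (𝟙 _)
      rw [L.map_id]))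
    (fun f => CategoricalPullback.hom_ext f.w
      ((Category.comp_id f.snd).trans (Category.id_comp f.snd).symm))
  counitIso := Iso.refl _
  functor_unitIso_comp x := Category.comp_id (𝟙 x.snd)

/-- The 2-pullback along an identity functor on the right. -/
def idRight (R : X ⥤ B) : CategoricalPullback R (𝟭 B) ≌ X where
  functor := CategoricalPullback.π₁ _ _
  inverse :=
    { obj x := ⟨x, R.obj x, Iso.refl _⟩
      map f := ⟨f, R.map f, by simp⟩ }
  unitIso := NatIso.ofComponents
    (fun x => CategoricalPullback.mkIso (Iso.refl _) x.iso.symm (by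
      change R.map (𝟙 _) ≫ 𝟙 _ = x.iso.hom ≫ x.iso.inv
      rw [R.map_id, Iso.hom_inv_id, Category.comp_id]))
    (fun f => CategoricalPullback.hom_ext
      ((Category.comp_id f.fst).trans (Category.id_comp f.fst).symm) f.w')
  counitIso := Iso.refl _
  functor_unitIso_comp x := Category.comp_id (𝟙 x.fst)

/-- Iterated 2-pullbacks are associative. -/
def assoc (R : X ⥤ B) (L : Y ⥤ B) (R' : Y ⥤ C)
    (L' : Z ⥤ C) :
    CategoricalPullback (CategoricalPullback.π₂ R L ⋙ R') L' ≌
      CategoricalPullback R (CategoricalPullback.π₁ R' L' ⋙ L) where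
  functor :=
    { obj x := ⟨x.fst.fst, ⟨x.fst.snd, x.snd, x.iso⟩, x.fst.iso⟩
      map f := ⟨f.fst.fst, ⟨f.fst.snd, f.snd, f.w⟩, f.fst.w⟩ }
  inverse :=
    { obj x := ⟨⟨x.fst, x.snd.fst, x.iso⟩, x.snd.snd, x.snd.iso⟩
      map f := ⟨⟨f.fst, f.snd.fst, f.w⟩, f.snd.snd, f.snd.w⟩ }
  unitIso := Iso.refl _
  counitIso := Iso.refl _
  functor_unitIso_comp x := Category.comp_id (𝟙 _)

/-- A 2-pullback of products is the product of the 2-pullbacks. -/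
def prod (R : X ⥤ B) (L : Y ⥤ B) (R' : X' ⥤ B') (L' : Y' ⥤ B') :
    CategoricalPullback (R.prod R') (L.prod L') ≌
      CategoricalPullback R L × CategoricalPullback R' L' where
  functor :=
    { obj x := (⟨x.fst.1, x.snd.1, (CategoryTheory.Prod.fst _ _).mapIso x.iso⟩,
        ⟨x.fst.2, x.snd.2, (CategoryTheory.Prod.snd _ _).mapIso x.iso⟩)
      map f := CategoryTheory.Prod.mkHom
        ⟨f.fst.1, f.snd.1, congrArg (fun g => g.1) f.w⟩
        ⟨f.fst.2, f.snd.2, congrArg (fun g => g.2) f.w⟩ }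
  inverse :=
    { obj x := ⟨(x.1.fst, x.2.fst), (x.1.snd, x.2.snd), Iso.prod x.1.iso x.2.iso⟩
      map f := ⟨f.1.fst ×ₘ f.2.fst, f.1.snd ×ₘ f.2.snd,
        CategoryTheory.Prod.hom_ext f.1.w f.2.w⟩ }
  unitIso := Iso.refl _
  counitIso := Iso.refl _
  functor_unitIso_comp x := Category.comp_id (𝟙 _)

end TwoPullback

set_option linter.checkUnivs false in
/-- The objects of the category of spans of groupoids: groupoids whose morphisms form sets in
universe `v` and whose objects form a set in universe `max u v`. -/
structure SpanGrpd : Type (max u v + 1) where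
  carrier : Type (max u v)
  [str : Groupoid.{v} carrier]

namespace SpanGrpd

attribute [instance] SpanGrpd.str

instance : CoeSort SpanGrpd.{v, u} (Type (max u v)) := ⟨SpanGrpd.carrier⟩

/-- A span of groupoids. -/
structure Span (A B : SpanGrpd.{v, u}) where
  apex : Type (max u v)
  [grpd : Groupoid.{v} apex]
  left : apex ⥤ A
  right : apex ⥤ B

attribute [instance] Span.grpd

namespace Span

variable {A B C D A' B' C' : SpanGrpd.{v, u}}

/-- Two spans are equivalent if there is an equivalence between their apices that commutes with
both legs up to natural isomorphism. -/
def Equivalent (S T : Span A B) : Prop :=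
  ∃ F : S.apex ⥤ T.apex, F.IsEquivalence ∧
    Nonempty (F ⋙ T.left ≅ S.left) ∧ Nonempty (F ⋙ T.right ≅ S.right)

instance setoid (A B : SpanGrpd.{v, u}) : Setoid (Span A B) where
  r := Equivalent
  iseqv :=
    { refl S := ⟨𝟭 _, inferInstance, ⟨S.left.leftUnitor⟩, ⟨S.right.leftUnitor⟩⟩
      symm := by
        rintro S T ⟨F, hF, ⟨l⟩, ⟨r⟩⟩
        refine ⟨F.inv, inferInstance, ⟨?_⟩, ⟨?_⟩⟩
        · exact Functor.isoWhiskerLeft F.inv l.symm ≪≫ (Functor.associator _ _ _).symm ≪≫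
            Functor.isoWhiskerRight F.asEquivalence.counitIso T.left ≪≫ T.left.leftUnitor
        · exact Functor.isoWhiskerLeft F.inv r.symm ≪≫ (Functor.associator _ _ _).symm ≪≫
            Functor.isoWhiskerRight F.asEquivalence.counitIso T.right ≪≫ T.right.leftUnitor
      trans := by
        rintro S T U ⟨F, hF, ⟨l⟩, ⟨r⟩⟩ ⟨G, hG, ⟨l'⟩, ⟨r'⟩⟩
        exact ⟨F ⋙ G, inferInstance,
          ⟨Functor.associator _ _ _ ≪≫ Functor.isoWhiskerLeft F l' ≪≫ l⟩,
          ⟨Functor.associator _ _ _ ≪≫ Functor.isoWhiskerLeft F r' ≪≫ r⟩⟩ }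

/-- The identity span. -/
def id (A : SpanGrpd.{v, u}) : Span A A := ⟨A, 𝟭 _, 𝟭 _⟩

/-- The composite of two spans, formed by a 2-pullback. -/
def comp (S : Span A B) (T : Span B C) : Span A C where
  apex := CategoricalPullback S.right T.left
  left := CategoricalPullback.π₁ _ _ ⋙ S.left
  right := CategoricalPullback.π₂ _ _ ⋙ T.right

/-- The product of two spans. -/
def prod (S : Span A B) (T : Span A' B') : Span ⟨A × A'⟩ ⟨B × B'⟩ where
  apex := S.apex × T.apex
  left := S.left.prod T.left
  right := S.right.prod T.right

/-- The span from `A` to `B` with identity left leg given by a functor. -/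
def graph (F : A ⥤ B) : Span A B := ⟨A, 𝟭 _, F⟩

theorem comp_congr {S S' : Span A B} {T T' : Span B C} (h : S ≈ S') (k : T ≈ T') :
    S.comp T ≈ S'.comp T' := by
  obtain ⟨F, hF, ⟨l⟩, ⟨r⟩⟩ := h
  obtain ⟨G, hG, ⟨l'⟩, ⟨r'⟩⟩ := k
  exact ⟨TwoPullback.map F G r l', TwoPullback.map_isEquivalence F G r l',
    ⟨Functor.isoWhiskerLeft (CategoricalPullback.π₁ _ _) l⟩,
    ⟨Functor.isoWhiskerLeft (CategoricalPullback.π₂ _ _) r'⟩⟩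

theorem prod_congr {S S' : Span A B} {T T' : Span A' B'} (h : S ≈ S') (k : T ≈ T') :
    S.prod T ≈ S'.prod T' := by
  obtain ⟨F, hF, ⟨l⟩, ⟨r⟩⟩ := h
  obtain ⟨G, hG, ⟨l'⟩, ⟨r'⟩⟩ := k
  exact ⟨F.prod G, (F.asEquivalence.prod G.asEquivalence).isEquivalence_functor,
    ⟨NatIso.prod l l'⟩, ⟨NatIso.prod r r'⟩⟩

theorem id_comp (S : Span A B) : (id A).comp S ≈ S :=
  ⟨(TwoPullback.idLeft S.left).functor, (TwoPullback.idLeft S.left).isEquivalence_functor,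
    ⟨(CatCommSq.iso (CategoricalPullback.π₁ (𝟭 A) S.left)
      (CategoricalPullback.π₂ (𝟭 A) S.left) (𝟭 A) S.left).symm⟩, ⟨Iso.refl _⟩⟩

theorem comp_graph (S : Span A B) (G : B ⥤ C) :
    S.comp (graph G) ≈ ⟨S.apex, S.left, S.right ⋙ G⟩ :=
  ⟨(TwoPullback.idRight S.right).functor, (TwoPullback.idRight S.right).isEquivalence_functor,
    ⟨Iso.refl _⟩, ⟨Functor.isoWhiskerRight
      (CatCommSq.iso (CategoricalPullback.π₁ S.right (𝟭 _)) (CategoricalPullback.π₂ S.right (𝟭 _))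
        S.right (𝟭 _)) G⟩⟩

theorem comp_id (S : Span A B) : S.comp (id B) ≈ S := comp_graph S (𝟭 _)

theorem comp_assoc (S : Span A B) (T : Span B C) (U : Span C D) :
    (S.comp T).comp U ≈ S.comp (T.comp U) :=
  ⟨(TwoPullback.assoc S.right T.left T.right U.left).functor,
    (TwoPullback.assoc S.right T.left T.right U.left).isEquivalence_functor,
    ⟨Iso.refl _⟩, ⟨Iso.refl _⟩⟩

theorem prod_comp (S : Span A B) (T : Span B C) (S' : Span A' B') (T' : Span B' C') :
    (S.prod S').comp (T.prod T') ≈ (S.comp T).prod (S'.comp T') :=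
  ⟨(TwoPullback.prod S.right T.left S'.right T'.left).functor,
    (TwoPullback.prod S.right T.left S'.right T'.left).isEquivalence_functor,
    ⟨Iso.refl _⟩, ⟨Iso.refl _⟩⟩

theorem graph_congr {F G : A ⥤ B} (e : F ≅ G) : graph F ≈ graph G :=
  ⟨𝟭 A, inferInstanceAs (𝟭 A).IsEquivalence, ⟨Iso.refl _⟩, ⟨e.symm⟩⟩

theorem graph_comp_graph (F : A ⥤ B) (G : B ⥤ C) : (graph F).comp (graph G) ≈ graph (F ⋙ G) :=
  comp_graph _ _

theorem graph_prod_graph (F : A ⥤ B) (G : A' ⥤ B') :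
    (graph F).prod (graph G) ≈ graph (A := ⟨A × A'⟩) (B := ⟨B × B'⟩) (F.prod G) :=
  ⟨𝟭 (A × A'), inferInstanceAs (𝟭 (A × A')).IsEquivalence, ⟨Iso.refl _⟩, ⟨Iso.refl _⟩⟩

theorem comp_graph_eq (S : Span A B) (T : Span A' B') (E : A ⥤ A') (hE : E.IsEquivalence)
    (G : B ⥤ B') (F : S.apex ⥤ T.apex) (hF : F.IsEquivalence) (l : S.left ⋙ E ≅ F ⋙ T.left)
    (r : F ⋙ T.right ≅ S.right ⋙ G) : S.comp (graph G) ≈ (graph E).comp T := by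
  refine Setoid.trans (comp_graph S G) ?_
  let K : S.apex ⥤ CategoricalPullback E T.left :=
    { obj x := ⟨S.left.obj x, F.obj x, l.app x⟩
      map f := ⟨S.left.map f, F.map f, l.hom.naturality f⟩ }
  have hM := TwoPullback.map_isEquivalence (R := E) (L := T.left) (R' := 𝟭 A') (L' := T.left)
    E (𝟭 _) (Iso.refl _) (Iso.refl _)
  have hπ : (CategoricalPullback.π₂ E T.left).IsEquivalence :=
    Functor.isEquivalence_trans
      (TwoPullback.map (R := E) (L := T.left) (R' := 𝟭 A') (L' := T.left)
        E (𝟭 _) (Iso.refl _) (Iso.refl _)) (TwoPullback.idLeft T.left).functor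
  have hK : (K ⋙ CategoricalPullback.π₂ E T.left).IsEquivalence := hF
  have : K.IsEquivalence := Functor.isEquivalence_of_comp_right K (CategoricalPullback.π₂ E T.left)
  exact ⟨K, this, ⟨Iso.refl _⟩, ⟨r⟩⟩

end Span

/-- Morphisms are equivalence classes of spans; they compose by 2-pullback. -/
instance category : Category.{max u v + 1} SpanGrpd.{v, u} where
  Hom A B := Quotient (Span.setoid A B)
  id A := Quotient.mk _ (Span.id A)
  comp f g := Quotient.map₂ Span.comp (fun _ _ h _ _ k => Span.comp_congr h k) f g
  id_comp f := Quotient.inductionOn f fun S => Quotient.sound (Span.id_comp S)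
  comp_id f := Quotient.inductionOn f fun S => Quotient.sound (Span.comp_id S)
  assoc f g h := Quotient.inductionOn₃ f g h fun S T U => Quotient.sound (Span.comp_assoc S T U)

/-- The morphism represented by a span. -/
def homMk {A B : SpanGrpd.{v, u}} (S : Span A B) : A ⟶ B := Quotient.mk _ S

set_option linter.checkUnivs false in
/-- The underlying type of the terminal groupoid. -/
inductive Point : Type (max u v)
  | point

instance : Groupoid.{v} Point.{v, u} where
  Hom _ _ := PUnit
  id _ := ⟨⟩
  comp _ _ := ⟨⟩
  inv _ := ⟨⟩

/-- The morphism represented by a functor. -/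
def graphHom {A B : SpanGrpd.{v, u}} (F : A ⥤ B) : A ⟶ B := homMk (Span.graph F)

section
variable {A B C A' B' : SpanGrpd.{v, u}}

theorem graphHom_congr {F G : A ⥤ B} (e : F ≅ G) : graphHom F = graphHom G :=
  Quotient.sound (Span.graph_congr e)

theorem graphHom_comp (F : A ⥤ B) (G : B ⥤ C) : graphHom F ≫ graphHom G = graphHom (F ⋙ G) :=
  Quotient.sound (Span.graph_comp_graph F G)

/-- An equivalence of groupoids induces an isomorphism. -/
def graphIso (e : A ≌ B) : A ≅ B where
  hom := graphHom e.functor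
  inv := graphHom e.inverse
  hom_inv_id := (graphHom_comp _ _).trans (graphHom_congr e.unitIso.symm)
  inv_hom_id := (graphHom_comp _ _).trans (graphHom_congr e.counitIso)

/-- The tensor product of morphisms. -/
def tensor (f : A ⟶ B) (g : A' ⟶ B') :
    (⟨A × A'⟩ : SpanGrpd.{v, u}) ⟶ (⟨B × B'⟩ : SpanGrpd.{v, u}) :=
  Quotient.map₂ Span.prod (fun _ _ h _ _ k => Span.prod_congr h k) f g

theorem tensor_graphHom (F : A ⥤ B) (G : A' ⥤ B') :
    tensor (graphHom F) (graphHom G) = graphHom (A := ⟨A × A'⟩) (B := ⟨B × B'⟩) (F.prod G) :=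
  Quotient.sound (Span.graph_prod_graph F G)

theorem tensor_graphHom_id (F : A ⥤ B) :
    tensor (graphHom F) (𝟙 A') = graphHom (A := ⟨A × A'⟩) (B := ⟨B × A'⟩) (F.prod (𝟭 A')) :=
  tensor_graphHom F (𝟭 A')

theorem tensor_id_graphHom (F : A ⥤ B) :
    tensor (𝟙 A') (graphHom F) = graphHom (A := ⟨A' × A⟩) (B := ⟨A' × B⟩) ((𝟭 A').prod F) :=
  tensor_graphHom (𝟭 A') F
end

/-- The equivalence `1 × A ≌ A`. -/
def leftUnitEquiv (A : Type (max u v)) [Groupoid.{v} A] : Point.{v, u} × A ≌ A where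
  functor := CategoryTheory.Prod.snd _ _
  inverse := Functor.prod' ((Functor.const _).obj .point) (𝟭 A)
  unitIso := NatIso.ofComponents (fun _ => Iso.refl _)
  counitIso := Iso.refl _

/-- The equivalence `A × 1 ≌ A`. -/
def rightUnitEquiv (A : Type (max u v)) [Groupoid.{v} A] : A × Point.{v, u} ≌ A where
  functor := CategoryTheory.Prod.fst _ _
  inverse := Functor.prod' (𝟭 A) ((Functor.const _).obj .point)
  unitIso := NatIso.ofComponents (fun _ => Iso.refl _)
  counitIso := Iso.refl _

/-- The tensor product is the product of groupoids and of spans, the unit is the terminal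
groupoid; the associator and the unitors are the evident ones. -/
instance monoidalStruct : MonoidalCategoryStruct SpanGrpd.{v, u} where
  tensorObj A B := ⟨A × B⟩
  tensorHom f g := tensor f g
  whiskerLeft A _ _ f := tensor (𝟙 A) f
  whiskerRight f B := tensor f (𝟙 B)
  tensorUnit := ⟨Point.{v, u}⟩
  associator A B C :=
    graphIso (A := ⟨(A × B) × C⟩) (B := ⟨A × (B × C)⟩) (prod.associativity A B C)
  leftUnitor A := graphIso (A := ⟨Point.{v, u} × A⟩) (leftUnitEquiv A)
  rightUnitor A := graphIso (A := ⟨A × Point.{v, u}⟩) (rightUnitEquiv A)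

instance monoidal : MonoidalCategory SpanGrpd.{v, u} :=
  MonoidalCategory.ofTensorHom
    (id_tensorHom_id := fun A B => tensor_graphHom (𝟭 A) (𝟭 B))
    (id_tensorHom := fun _ _ _ _ => rfl)
    (tensorHom_id := fun _ _ => rfl)
    (tensorHom_comp_tensorHom := fun f₁ f₂ g₁ g₂ =>
      Quotient.inductionOn₂ f₁ g₁ fun S T => Quotient.inductionOn₂ f₂ g₂ fun S' T' =>
        Quotient.sound (Span.prod_comp S T S' T'))
    (associator_naturality := fun f₁ f₂ f₃ =>
      Quotient.inductionOn₃ f₁ f₂ f₃ fun S₁ S₂ S₃ => Quotient.sound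
        (Span.comp_graph_eq ((S₁.prod S₂).prod S₃) (S₁.prod (S₂.prod S₃)) _
          (prod.associativity _ _ _).isEquivalence_functor _
          (prod.associativity S₁.apex S₂.apex S₃.apex).functor
          (prod.associativity S₁.apex S₂.apex S₃.apex).isEquivalence_functor (Iso.refl _) (Iso.refl _)))
    (leftUnitor_naturality := fun f =>
      Quotient.inductionOn f fun S => Quotient.sound
        (Span.comp_graph_eq ((Span.id ⟨Point.{v, u}⟩).prod S) S _
          (leftUnitEquiv _).isEquivalence_functor _
          (leftUnitEquiv S.apex).functor (leftUnitEquiv S.apex).isEquivalence_functor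
          (Iso.refl _) (Iso.refl _)))
    (rightUnitor_naturality := fun f =>
      Quotient.inductionOn f fun S => Quotient.sound
        (Span.comp_graph_eq (S.prod (Span.id ⟨Point.{v, u}⟩)) S _
          (rightUnitEquiv _).isEquivalence_functor _
          (rightUnitEquiv S.apex).functor (rightUnitEquiv S.apex).isEquivalence_functor
          (Iso.refl _) (Iso.refl _)))
    (pentagon := fun A B C D => by
      change tensor (graphHom _) (𝟙 D) ≫ graphHom _ ≫ tensor (𝟙 A) (graphHom _) =
        graphHom _ ≫ graphHom _
      erw [tensor_graphHom_id, tensor_id_graphHom, graphHom_comp, graphHom_comp, graphHom_comp]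
      rfl)
    (triangle := fun A B => by
      change graphHom _ ≫ tensor (𝟙 A) (graphHom _) = tensor (graphHom _) (𝟙 B)
      erw [tensor_graphHom_id, tensor_id_graphHom, graphHom_comp]
      rfl)

end SpanGrpd

/-- A category is proto-abelian if it has a zero object, spans `C ↞ A ↪ B` and cospans
`C ↪ D ↞ B` complete to pushout, respectively pullback, squares with two parallel monomorphisms
and two parallel epimorphisms, and a commutative square of this form is a pushout if and only if
it is a pullback. -/
structure IsProtoAbelian (C : Type u) [Category.{v} C] : Prop where
  pointed : HasZeroObject C
  exists_isPushout {A B A' : C} (i : A ⟶ B) (p : A ⟶ A') [Mono i] [Epi p] :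
    ∃ (B' : C) (q : B ⟶ B') (j : A' ⟶ B'), Epi q ∧ Mono j ∧ IsPushout i p q j
  exists_isPullback {B A' B' : C} (q : B ⟶ B') (j : A' ⟶ B') [Epi q] [Mono j] :
    ∃ (A : C) (i : A ⟶ B) (p : A ⟶ A'), Mono i ∧ Epi p ∧ IsPullback i p q j
  isPushout_iff_isPullback {A B A' B' : C} (i : A ⟶ B) (p : A ⟶ A') (q : B ⟶ B') (j : A' ⟶ B')
    [Mono i] [Epi p] [Epi q] [Mono j] (w : i ≫ q = p ≫ j) :
    IsPushout i p q j ↔ IsPullback i p q j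

namespace Flag

/-- The index poset `{(i, j) | 0 ≤ i ≤ j ≤ n}`, ordered componentwise. -/
abbrev Shape (n : ℕ) : Type := {p : Fin (n + 1) × Fin (n + 1) // p.1 ≤ p.2}

/-- The monotone map of index posets given by a monotone map `[m] → [n]`. -/
def Shape.map {m n : ℕ} (φ : Fin (m + 1) →o Fin (n + 1)) : Shape m →o Shape n where
  toFun p := ⟨(φ p.1.1, φ p.1.2), φ.monotone p.2⟩
  monotone' _ _ h := ⟨φ.monotone h.1, φ.monotone h.2⟩

variable {C : Type u} [Category.{v} C]

/-- The horizontal map `A i j ⟶ A i k`. -/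
def hor {n : ℕ} (A : Shape n ⥤ C) {i j k : Fin (n + 1)} (hij : i ≤ j) (hjk : j ≤ k) :
    A.obj ⟨(i, j), hij⟩ ⟶ A.obj ⟨(i, k), hij.trans hjk⟩ :=
  A.map (homOfLE ⟨le_rfl, hjk⟩)

/-- The vertical map `A i k ⟶ A j k`. -/
def ver {n : ℕ} (A : Shape n ⥤ C) {i j k : Fin (n + 1)} (hij : i ≤ j) (hjk : j ≤ k) :
    A.obj ⟨(i, k), hij.trans hjk⟩ ⟶ A.obj ⟨(j, k), hjk⟩ :=
  A.map (homOfLE ⟨hij, le_rfl⟩)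

/-- The triangular diagrams of flags of length `n`, for a fixed zero object `Z`: the diagonal
entries are `Z`, horizontal maps are monomorphisms, vertical maps are epimorphisms, and all
squares are both pushouts and pullbacks. By composing maps and pasting squares, it amounts to the
same to impose the last three conditions only on maps and squares between neighbouring entries. -/
structure IsFlag (Z : C) (n : ℕ) (A : Shape n ⥤ C) : Prop where
  diag (i : Fin (n + 1)) : A.obj ⟨(i, i), le_rfl⟩ = Z
  mono {i j k : Fin (n + 1)} (hij : i ≤ j) (hjk : j ≤ k) : Mono (hor A hij hjk)
  epi {i j k : Fin (n + 1)} (hij : i ≤ j) (hjk : j ≤ k) : Epi (ver A hij hjk)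
  isPushout {i i' j j' : Fin (n + 1)} (hi : i ≤ i') (hij : i' ≤ j) (hj : j ≤ j') :
    IsPushout (hor A (hi.trans hij) hj) (ver A hi hij) (ver A hi (hij.trans hj)) (hor A hij hj)
  isPullback {i i' j j' : Fin (n + 1)} (hi : i ≤ i') (hij : i' ≤ j) (hj : j ≤ j') :
    IsPullback (hor A (hi.trans hij) hj) (ver A hi hij) (ver A hi (hij.trans hj)) (hor A hij hj)

/-- The category of flag diagrams of length `n`. -/
abbrev Diagram (Z : C) (n : ℕ) := ObjectProperty.FullSubcategory (IsFlag Z n)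

/-- The groupoid `S_n` of flags of length `n`: the maximal groupoid in the category of flag
diagrams of length `n`. -/
def S (Z : C) (n : ℕ) : SpanGrpd.{v, u} where
  carrier := Core (Diagram Z n)

/-- The functor on flag diagrams given by restriction along a monotone map `[m] → [n]`. -/
def restrictDiagram (Z : C) {m n : ℕ} (φ : Fin (m + 1) →o Fin (n + 1)) :
    Diagram Z n ⥤ Diagram Z m :=
  ObjectProperty.lift _
    (ObjectProperty.ι _ ⋙ (Functor.whiskeringLeft _ _ C).obj (Shape.map φ).monotone.functor)
    fun A => by
      exact
      { diag i := A.property.diag (φ i)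
        mono hij hjk := A.property.mono (φ.monotone hij) (φ.monotone hjk)
        epi hij hjk := A.property.epi (φ.monotone hij) (φ.monotone hjk)
        isPushout hi hij hj :=
          A.property.isPushout (φ.monotone hi) (φ.monotone hij) (φ.monotone hj)
        isPullback hi hij hj :=
          A.property.isPullback (φ.monotone hi) (φ.monotone hij) (φ.monotone hj) }

/-- The simplicial structure functor `S_n ⥤ S_m` given by a monotone map `[m] → [n]`. -/
def restrict (Z : C) {m n : ℕ} (φ : Fin (m + 1) →o Fin (n + 1)) : S Z n ⥤ S Z m :=
  (restrictDiagram Z φ).core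

/-- The face functor `∂_k`, which omits the `k`-th row and the `k`-th column. -/
def face (Z : C) {n : ℕ} (k : Fin (n + 2)) : S Z (n + 1) ⥤ S Z n :=
  restrict Z (Fin.succAboveOrderEmb k).toOrderHom

/-- The degeneracy functor `σ_k`, which repeats the `k`-th row and the `k`-th column. -/
def degeneracy (Z : C) {n : ℕ} (k : Fin (n + 1)) : S Z n ⥤ S Z (n + 1) :=
  restrict Z ⟨k.predAbove, Fin.predAbove_right_monotone k⟩

open scoped MonoidalCategory

/-- The multiplication `μ`, represented by the span `S_1 × S_1 ← S_2 → S_1`. Its left leg takes the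
parts of a flag on `{0, 1}` and `{1, 2}`, its right leg the part on `{0, 2}`. -/
def mul (Z : C) : S Z 1 ⊗ S Z 1 ⟶ S Z 1 :=
  SpanGrpd.homMk
    { apex := S Z 2
      left := Functor.prod' (face Z 2) (face Z 0)
      right := face Z 1 }

/-- The unit `e`, represented by the span `S_0 ← S_0 → S_1` with left leg the identity. -/
def unit (Z : C) : S Z 0 ⟶ S Z 1 :=
  SpanGrpd.homMk
    { apex := S Z 0
      left := 𝟭 _
      right := degeneracy Z 0 }

/-- The identification of the monoidal unit, the terminal groupoid `1`, with `S_0`, represented by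
the span `1 ← S_0 → S_0` with right leg the identity. -/
def fromTensorUnit (Z : C) : 𝟙_ SpanGrpd.{v, u} ⟶ S Z 0 :=
  SpanGrpd.homMk
    { apex := S Z 0
      left := (Functor.const _).obj SpanGrpd.Point.point
      right := 𝟭 _ }

end Flag

/-! A flag is a filtration `A_{01} ↪ ... ↪ A_{0n}` of its total object together with all
subquotients: `A_{ij}` is the pushout of `A_{0j}` along `A_{0i} ↠ 0`, and `A_{0j}` is the pullback
of `0 ↪ A_{jn}` along `A_{0n} ↠ A_{jn}`. Hence an isomorphism of flags is the same as an isomorphism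
of total objects that, together with its inverse, respects the filtrations (`hom_ext`,
`exists_hom`), and every chain of subobjects starting at zero is, up to isomorphism, the top row of
a flag (`exists_isFlag_of_chain`).

Associativity follows because both bracketings of the triple product have an apex equivalent to
`S_3`; these are the 2-Segal conditions for the squares glued from two triangles. Along the edge
`{0, 2}`, a filtration of `A_{02}` and an embedding `A_{02} ↪ A_{03}` compose to a longer chain
(`exists_flag_left`). Along the edge `{1, 3}`, a subobject of the quotient `A_{13}` of `A_{03}` is
pulled back to a subobject of `A_{03}` containing `A_{01}` (`exists_flag_right`). The remaining
`S_1` factor in each apex is determined up to isomorphism by the flags of length two.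

For the unit, `S_0` is contractible, and in a flag of length two with `A_{01}` zero the map `A_{02}
↠ A_{12}` is invertible, dually `A_{01} ↪ A_{02}` when `A_{12}` is zero. The apex of the composite
with the unit therefore projects by an equivalence to `1 × S_1` or `S_1 × 1`, and these invertible
maps give the 2-cell between its right leg and the unitor. -/

namespace IsProtoAbelian

variable {C : Type u} [Category.{v} C]

/-- In a proto-abelian category, monomorphisms are stable under pushouts along epimorphisms. -/
theorem mono_of_isPushout (hC : IsProtoAbelian C) {A B A' B' : C} {i : A ⟶ B} {p : A ⟶ A'}
    {q : B ⟶ B'} {j : A' ⟶ B'} [Mono i] [Epi p] (h : IsPushout i p q j) : Mono j := by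
  obtain ⟨B₁, q₁, j₁, _, _, h₁⟩ := hC.exists_isPushout i p
  have e := IsPushout.inr_isoIsPushout_hom B A' h₁ h
  rw [← e]
  exact mono_comp _ _

end IsProtoAbelian

/-! ### Flags and their morphisms in terms of the filtration of the total object -/

namespace Flag

variable {C : Type u} [Category.{v} C] {Z : C} {n : ℕ}

theorem hor_comp_ver (A : Shape n ⥤ C) {i i' j j' : Fin (n + 1)} (hi : i ≤ i') (hij : i' ≤ j)
    (hj : j ≤ j') :
    hor A (hi.trans hij) hj ≫ ver A hi (hij.trans hj) = ver A hi hij ≫ hor A hij hj := by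
  simp only [hor, ver, ← A.map_comp]
  rfl

theorem hor_comp_ver_assoc (A : Shape n ⥤ C) {i i' j j' : Fin (n + 1)} (hi : i ≤ i') (hij : i' ≤ j)
    (hj : j ≤ j') {X : C} (f : A.obj ⟨(i', j'), hij.trans hj⟩ ⟶ X) :
    hor A (hi.trans hij) hj ≫ ver A hi (hij.trans hj) ≫ f = ver A hi hij ≫ hor A hij hj ≫ f := by
  rw [← Category.assoc, hor_comp_ver A hi hij hj, Category.assoc]

theorem hor_comp_hor (A : Shape n ⥤ C) {i j k l : Fin (n + 1)} (hij : i ≤ j) (hjk : j ≤ k)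
    (hkl : k ≤ l) : hor A hij hjk ≫ hor A (hij.trans hjk) hkl = hor A hij (hjk.trans hkl) := by
  simp only [hor, ← A.map_comp]
  rfl

theorem hor_comp_hor_assoc (A : Shape n ⥤ C) {i j k l : Fin (n + 1)} (hij : i ≤ j) (hjk : j ≤ k)
    (hkl : k ≤ l) {X : C} (f : A.obj ⟨(i, l), hij.trans (hjk.trans hkl)⟩ ⟶ X) :
    hor A hij hjk ≫ hor A (hij.trans hjk) hkl ≫ f = hor A hij (hjk.trans hkl) ≫ f := by
  rw [← Category.assoc, hor_comp_hor A hij hjk hkl]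

theorem ver_comp_ver (A : Shape n ⥤ C) {i j k l : Fin (n + 1)} (hij : i ≤ j) (hjk : j ≤ k)
    (hkl : k ≤ l) : ver A hij (hjk.trans hkl) ≫ ver A hjk hkl = ver A (hij.trans hjk) hkl := by
  simp only [ver, ← A.map_comp]
  rfl

theorem ver_comp_ver_assoc (A : Shape n ⥤ C) {i j k l : Fin (n + 1)} (hij : i ≤ j) (hjk : j ≤ k)
    (hkl : k ≤ l) {X : C} (f : A.obj ⟨(k, l), hkl⟩ ⟶ X) :
    ver A hij (hjk.trans hkl) ≫ ver A hjk hkl ≫ f = ver A (hij.trans hjk) hkl ≫ f := by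
  rw [← Category.assoc, ver_comp_ver A hij hjk hkl]

theorem map_eq (A : Shape n ⥤ C) {p q : Shape n} (f : p ⟶ q) :
    A.map f = hor A p.2 (leOfHom f).2 ≫ ver A (leOfHom f).1 q.2 := by
  simp only [hor, ver, ← A.map_comp]
  rfl

theorem hor_naturality {A B : Shape n ⥤ C} (γ : A ⟶ B) {i j k : Fin (n + 1)} (hij : i ≤ j)
    (hjk : j ≤ k) : hor A hij hjk ≫ γ.app ⟨(i, k), hij.trans hjk⟩ =
      γ.app ⟨(i, j), hij⟩ ≫ hor B hij hjk :=
  γ.naturality _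

theorem ver_naturality {A B : Shape n ⥤ C} (γ : A ⟶ B) {i j k : Fin (n + 1)} (hij : i ≤ j)
    (hjk : j ≤ k) : ver A hij hjk ≫ γ.app ⟨(j, k), hjk⟩ =
      γ.app ⟨(i, k), hij.trans hjk⟩ ≫ ver B hij hjk :=
  γ.naturality _

/-- The index `(0, n)` of the total object of a flag. -/
abbrev Shape.top (n : ℕ) : Shape n := ⟨(0, Fin.last n), Fin.zero_le _⟩

/-- Every entry is a subquotient of the total object: cancelling the epimorphism from `A_{0j}` to
`A_{ij}` reduces to the top row, and cancelling the monomorphism from `B_{0j}` to `B_{0n}` reduces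
to the total object. -/
theorem IsFlag.hom_ext {A B : Shape n ⥤ C} (hA : IsFlag Z n A) (hB : IsFlag Z n B) {γ δ : A ⟶ B}
    (h : γ.app (Shape.top n) = δ.app (Shape.top n)) : γ = δ := by
  ext ⟨⟨i, j⟩, hij⟩
  have := hA.epi (Fin.zero_le i) hij
  have := hB.mono (Fin.zero_le j) (Fin.le_last j)
  rw [← cancel_epi (ver A (Fin.zero_le i) hij), ver_naturality, ver_naturality]
  congr 1
  rw [← cancel_mono (hor B (Fin.zero_le j) (Fin.le_last j)), ← hor_naturality, ← hor_naturality, h]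

section

variable [HasZeroMorphisms C]

/-- The composite factors through the diagonal entry `A_{jj}`. -/
theorem IsFlag.hor_comp_ver_eq_zero {A : Shape n ⥤ C} (hA : IsFlag Z n A) (hZ : IsZero Z)
    {i j k : Fin (n + 1)} (hij : i ≤ j) (hjk : j ≤ k) : hor A hij hjk ≫ ver A hij hjk = 0 := by
  have h : IsZero (A.obj ⟨(j, j), le_rfl⟩) := by rw [hA.diag]; exact hZ
  rw [hor_comp_ver A hij le_rfl hjk, h.eq_zero_of_tgt (ver A hij le_rfl), zero_comp]

/-- A morphism between total objects extends to a morphism of flags if it preserves the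
subobjects of the flags. -/
theorem IsFlag.exists_hom {A B : Shape n ⥤ C} (hA : IsFlag Z n A) (hB : IsFlag Z n B)
    (hZ : IsZero Z) (α : A.obj (Shape.top n) ⟶ B.obj (Shape.top n))
    (h : ∀ j, hor A (Fin.zero_le j) (Fin.le_last j) ≫ α ≫
      ver B (Fin.zero_le j) (Fin.le_last j) = 0) :
    ∃ γ : A ⟶ B, γ.app (Shape.top n) = α := by
  have h0 (i : Fin (n + 1)) : IsZero (A.obj ⟨(i, i), le_rfl⟩) := by rw [hA.diag]; exact hZ
  have h0' (i : Fin (n + 1)) : IsZero (B.obj ⟨(i, i), le_rfl⟩) := by rw [hB.diag]; exact hZ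
  have hβ (j : Fin (n + 1)) : ∃ β : A.obj ⟨(0, j), Fin.zero_le j⟩ ⟶ B.obj ⟨(0, j), Fin.zero_le j⟩,
      β ≫ hor B (Fin.zero_le j) (Fin.le_last j) =
        hor A (Fin.zero_le j) (Fin.le_last j) ≫ α := by
    -- With `B_{jj}` zero this square presents `B_{0j}` as the kernel of the map from `B_{0n}` to
    -- `B_{jn}`, so `h j` says that `α` restricts to the top row.
    have hp := hB.isPullback (Fin.zero_le j) le_rfl (Fin.le_last j)
    exact ⟨hp.lift (hor A (Fin.zero_le j) (Fin.le_last j) ≫ α) 0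
      (by rw [zero_comp, Category.assoc]; exact h j), hp.lift_fst _ _ _⟩
  choose β hβ using hβ
  have hβn {j k : Fin (n + 1)} (hjk : j ≤ k) : hor A (Fin.zero_le j) hjk ≫ β k =
      β j ≫ hor B (Fin.zero_le j) hjk := by
    have := hB.mono (Fin.zero_le k) (Fin.le_last k)
    rw [← cancel_mono (hor B (Fin.zero_le k) (Fin.le_last k)), Category.assoc, hβ,
      Category.assoc, hor_comp_hor, hor_comp_hor_assoc, hβ]
  have hγ (p : Shape n) : ∃ γ : A.obj p ⟶ B.obj p,
      ver A (Fin.zero_le p.1.1) p.2 ≫ γ = β p.1.2 ≫ ver B (Fin.zero_le p.1.1) p.2 := by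
    -- Dually, `A_{ij}` is the cokernel of the map from `A_{0i}` to `A_{0j}`, so the maps `β` on the
    -- top row descend to the quotients.
    have hp := hA.isPushout (Fin.zero_le p.1.1) le_rfl p.2
    refine ⟨hp.desc (β p.1.2 ≫ ver B (Fin.zero_le p.1.1) p.2) 0 ?_, hp.inl_desc _ _ _⟩
    rw [comp_zero, ← Category.assoc, hβn, Category.assoc, hB.hor_comp_ver_eq_zero hZ, comp_zero]
  choose γ hγ using hγ
  refine ⟨{ app := γ, naturality := ?_ }, ?_⟩
  · rintro ⟨⟨i, j⟩, hij⟩ ⟨⟨i', j'⟩, hij'⟩ f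
    have hi : i ≤ i' := (leOfHom f).1
    have hj : j ≤ j' := (leOfHom f).2
    have := hA.epi (Fin.zero_le i) hij
    have e1 := hγ ⟨(i, j), hij⟩
    have e2 := hγ ⟨(i', j'), hij'⟩
    dsimp only at e1 e2
    rw [← cancel_epi (ver A (Fin.zero_le i) hij), reassoc_of% e1, map_eq, map_eq]
    dsimp only
    rw [Category.assoc, ← hor_comp_ver_assoc A (Fin.zero_le i) hij hj, ver_comp_ver_assoc, e2,
      ← hor_comp_ver_assoc B (Fin.zero_le i) hij hj, ver_comp_ver, ← reassoc_of% (hβn hj)]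
  · have h1 := hγ (Shape.top n)
    have h2 := hβ (Fin.last n)
    have e1 : ver A (Fin.zero_le (0 : Fin (n + 1))) (Fin.zero_le (Fin.last n)) = 𝟙 _ := A.map_id _
    have e2 : ver B (Fin.zero_le (0 : Fin (n + 1))) (Fin.zero_le (Fin.last n)) = 𝟙 _ := B.map_id _
    have e3 : hor A (Fin.zero_le (Fin.last n)) (Fin.le_last _) = 𝟙 _ := A.map_id _
    have e4 : hor B (Fin.zero_le (Fin.last n)) (Fin.le_last _) = 𝟙 _ := B.map_id _
    dsimp only at h1
    rw [e1, e2, Category.id_comp, Category.comp_id] at h1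
    rw [e3, e4, Category.id_comp, Category.comp_id] at h2
    exact h1.trans h2

end

/-! ### Flags from chains of subobjects -/

section

variable {C : Type u} [Category.{v} C] {Z : C} {n : ℕ} [HasZeroMorphisms C]

/-- A chain of subobjects of `T` that starts with a zero object and ends with `T` is the top row
of a flag. -/
theorem exists_isFlag_of_chain (hC : IsProtoAbelian C) (hZ : IsZero Z) {T : C}
    (X : Fin (n + 1) → Over T) (hX : ∀ j, Mono (X j).hom)
    (hle : ∀ i j, i ≤ j → Nonempty (X i ⟶ X j)) (h0 : IsZero (X 0).left) :
    ∃ A : Shape n ⥤ C, IsFlag Z n A ∧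
      ∃ e : ∀ j, A.obj ⟨(0, j), Fin.zero_le j⟩ ≅ (X j).left,
        ∀ (i j : Fin (n + 1)) (hij : i ≤ j),
          (e i).hom ≫ (X i).hom = hor A (Fin.zero_le i) hij ≫ (e j).hom ≫ (X j).hom := by
  have hf (i j : Fin (n + 1)) (hij : i ≤ j) : ∃ f : (X i).left ⟶ (X j).left,
      f ≫ (X j).hom = (X i).hom := (hle i j hij).elim fun f => ⟨f.left, Over.w f⟩
  choose f hf using hf
  have hfm {i j : Fin (n + 1)} (hij : i ≤ j) : Mono (f i j hij) := by
    have : Mono (f i j hij ≫ (X j).hom) := by rw [hf]; exact hX i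
    exact mono_of_mono _ (X j).hom
  have hff {i j k : Fin (n + 1)} (hij : i ≤ j) (hjk : j ≤ k) :
      f i j hij ≫ f j k hjk = f i k (hij.trans hjk) := by
    have := hX k
    rw [← cancel_mono (X k).hom, Category.assoc, hf, hf, hf]
  have hfi (i : Fin (n + 1)) : f i i le_rfl = 𝟙 _ := by
    have := hX i
    rw [← cancel_mono (X i).hom, hf, Category.id_comp]
  have hz {Y : C} : Epi (0 : Y ⟶ Z) := ⟨fun _ _ _ => hZ.eq_of_src _ _⟩
  have hQ (p : Shape n) : ∃ (Q : C) (q : (X p.1.2).left ⟶ Q) (z : Z ⟶ Q),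
      IsPushout (f p.1.1 p.1.2 p.2) 0 q z ∧ (p.1.1 = p.1.2 → Q = Z) := by
    obtain ⟨⟨i, j⟩, hij⟩ := p
    -- `IsFlag.diag` asks for an equality of objects, so on the diagonal the quotient must be `Z`
    -- itself and not just some zero object.
    by_cases h : i = j
    · subst h
      refine ⟨Z, 0, 𝟙 Z, ?_, fun _ => rfl⟩
      dsimp only
      rw [hfi]
      exact IsPushout.of_horiz_isIso ⟨by simp⟩
    · have := hfm hij
      obtain ⟨Q, q, z, -, -, hq⟩ := hC.exists_isPushout (f i j hij) (0 : (X i).left ⟶ Z)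
      exact ⟨Q, q, z, hq, fun h' => absurd h' h⟩
  choose Q q z hQ hQZ using hQ
  have hzero (p : Shape n) : z p = 0 := hZ.eq_of_src _ _
  have hw (p : Shape n) : f p.1.1 p.1.2 p.2 ≫ q p = 0 := by
    rw [(hQ p).w, zero_comp]
  have hqe (p : Shape n) : Epi (q p) := ⟨fun g g' h =>
    (hQ p).hom_ext h (hZ.eq_of_src _ _)⟩
  have hm {p r : Shape n} (φ : p ⟶ r) : ∃ m : Q p ⟶ Q r,
      q p ≫ m = f p.1.2 r.1.2 (leOfHom φ).2 ≫ q r := by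
    have h1 : p.1.1 ≤ r.1.1 := (leOfHom φ).1
    refine ⟨(hQ p).desc (f p.1.2 r.1.2 (leOfHom φ).2 ≫ q r) 0 ?_, (hQ p).inl_desc _ _ _⟩
    rw [comp_zero, ← Category.assoc, hff, ← hff h1 r.2, Category.assoc, hw, comp_zero]
  choose m hm using @hm
  let A : Shape n ⥤ C :=
    { obj := Q
      map := m
      map_id p := by
        have := hqe p
        rw [← cancel_epi (q p), hm, hfi, Category.id_comp, Category.comp_id]
      map_comp {p r s} φ ψ := by
        have := hqe p
        rw [← cancel_epi (q p), hm, reassoc_of% hm φ, hm, ← Category.assoc, hff] }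
  have hAhor {i j k : Fin (n + 1)} (hij : i ≤ j) (hjk : j ≤ k) :
      q ⟨(i, j), hij⟩ ≫ hor A hij hjk = f j k hjk ≫ q ⟨(i, k), hij.trans hjk⟩ := hm _
  have hAver {i j k : Fin (n + 1)} (hij : i ≤ j) (hjk : j ≤ k) :
      q ⟨(i, k), hij.trans hjk⟩ ≫ ver A hij hjk = q ⟨(j, k), hjk⟩ := by
    refine (hm _).trans ?_
    dsimp only
    rw [hfi, Category.id_comp]
  have hAp {i j k : Fin (n + 1)} (hij : i ≤ j) (hjk : j ≤ k) :
      IsPushout (f j k hjk) (q ⟨(i, j), hij⟩) (q ⟨(i, k), hij.trans hjk⟩) (hor A hij hjk) := by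
    -- The squares defining the quotients by `X i` of `X j` and of `X k` are pushouts; cancelling
    -- the first from the second leaves this square.
    refine IsPushout.of_left ?_ (hAhor hij hjk).symm (hQ ⟨(i, j), hij⟩)
    dsimp only
    have e : z ⟨(i, j), hij⟩ ≫ hor A hij hjk = z ⟨(i, k), hij.trans hjk⟩ := hZ.eq_of_src _ _
    rw [e, hff]
    exact hQ ⟨(i, k), hij.trans hjk⟩
  have hAmono {i j k : Fin (n + 1)} (hij : i ≤ j) (hjk : j ≤ k) : Mono (hor A hij hjk) := by
    have := hfm hjk
    have := hqe ⟨(i, j), hij⟩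
    exact hC.mono_of_isPushout (hAp hij hjk)
  have hAepi {i j k : Fin (n + 1)} (hij : i ≤ j) (hjk : j ≤ k) : Epi (ver A hij hjk) := by
    have : Epi (q ⟨(i, k), hij.trans hjk⟩ ≫ ver A hij hjk) := by rw [hAver]; exact hqe _
    exact epi_of_epi (q ⟨(i, k), hij.trans hjk⟩) _
  have hApush {i i' j j' : Fin (n + 1)} (hi : i ≤ i') (hij : i' ≤ j) (hj : j ≤ j') :
      IsPushout (hor A (hi.trans hij) hj) (ver A hi hij) (ver A hi (hij.trans hj))
        (hor A hij hj) := by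
    -- Placed below the pushout square over `X j ⟶ X j'` for `i`, the square in question completes
    -- it to the one for `i'`, again a pushout.
    refine IsPushout.of_top ?_ (hor_comp_ver A hi hij hj) (hAp (hi.trans hij) hj)
    rw [hAver, hAver]
    exact hAp hij hj
  refine ⟨A, ⟨fun i => hQZ _ rfl, hAmono, hAepi, hApush, ?_⟩, ?_⟩
  · intro i i' j j' hi hij hj
    have := hAmono (hi.trans hij) hj
    have := hAmono hij hj
    have := hAepi hi hij
    have := hAepi hi (hij.trans hj)
    exact (hC.isPushout_iff_isPullback _ _ _ _ (hor_comp_ver A hi hij hj)).1 (hApush hi hij hj)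
  -- Since `X 0` is zero, passing to the quotient by it changes nothing.
  · have hiso (j : Fin (n + 1)) : IsIso (q ⟨(0, j), Fin.zero_le j⟩) := by
      have := hQ ⟨(0, j), Fin.zero_le j⟩
      have : IsIso (0 : (X 0).left ⟶ Z) := ⟨0, h0.eq_of_src _ _, hZ.eq_of_src _ _⟩
      exact (hQ ⟨(0, j), Fin.zero_le j⟩).isIso_inl_of_isIso
    refine ⟨fun j => (asIso (q ⟨(0, j), Fin.zero_le j⟩)).symm, fun i j hij => ?_⟩
    have h := hAhor (Fin.zero_le i) hij
    rw [← cancel_epi (q ⟨(0, i), Fin.zero_le i⟩), reassoc_of% h]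
    simp [hf]

end

/-! ### Isomorphisms and gluing of short flags -/

section

variable {C : Type u} [Category.{v} C] {Z : C} {n : ℕ}

/-- The diagram underlying a flag. -/
def diagram (A : S Z n) : Shape n ⥤ C :=
  ObjectProperty.FullSubcategory.obj (Core.of A)

theorem isFlag (A : S Z n) : IsFlag Z n (diagram A) :=
  ObjectProperty.FullSubcategory.property (Core.of A)

/-- The flag given by a diagram. -/
def ofDiagram {A : Shape n ⥤ C} (hA : IsFlag Z n A) : S Z n :=
  (⟨⟨A, hA⟩⟩ : Core (Diagram Z n))

/-- The component of a morphism of flags at an index. -/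
def comp {A B : S Z n} (f : A ⟶ B) (p : Shape n) : (diagram A).obj p ≅ (diagram B).obj p :=
  ((ObjectProperty.ι _).mapIso (CoreHom.iso f)).app p

theorem comp_hor {A B : S Z n} (f : A ⟶ B) {i j k : Fin (n + 1)} (hij : i ≤ j) (hjk : j ≤ k) :
    hor (diagram A) hij hjk ≫ (comp f ⟨(i, k), hij.trans hjk⟩).hom =
      (comp f ⟨(i, j), hij⟩).hom ≫ hor (diagram B) hij hjk :=
  hor_naturality _ _ _

theorem comp_ver {A B : S Z n} (f : A ⟶ B) {i j k : Fin (n + 1)} (hij : i ≤ j) (hjk : j ≤ k) :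
    ver (diagram A) hij hjk ≫ (comp f ⟨(j, k), hjk⟩).hom =
      (comp f ⟨(i, k), hij.trans hjk⟩).hom ≫ ver (diagram B) hij hjk :=
  ver_naturality _ _ _

theorem isZero_diag (A : S Z n) (hZ : IsZero Z) (i : Fin (n + 1)) :
    IsZero ((diagram A).obj ⟨(i, i), le_rfl⟩) := by
  rw [(isFlag A).diag]; exact hZ

theorem hom_ext {A B : S Z n} {f g : A ⟶ B}
    (h : (comp f (Shape.top n)).hom = (comp g (Shape.top n)).hom) : f = g :=
  Core.hom_ext (ObjectProperty.hom_ext _ ((isFlag A).hom_ext (isFlag B) h))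

/-- `α` and its inverse extend separately; the extensions are mutually inverse because a morphism of
flags is determined on the total object. -/
theorem exists_hom [HasZeroMorphisms C] (hZ : IsZero Z) {A B : S Z n}
    (α : (diagram A).obj (Shape.top n) ≅ (diagram B).obj (Shape.top n))
    (h : ∀ j, hor (diagram A) (Fin.zero_le j) (Fin.le_last j) ≫ α.hom ≫
      ver (diagram B) (Fin.zero_le j) (Fin.le_last j) = 0)
    (h' : ∀ j, hor (diagram B) (Fin.zero_le j) (Fin.le_last j) ≫ α.inv ≫
      ver (diagram A) (Fin.zero_le j) (Fin.le_last j) = 0) :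
    ∃ f : A ⟶ B, (comp f (Shape.top n)).hom = α.hom := by
  obtain ⟨γ, hγ⟩ := (isFlag A).exists_hom (isFlag B) hZ α.hom h
  obtain ⟨δ, hδ⟩ := (isFlag B).exists_hom (isFlag A) hZ α.inv h'
  let e : diagram A ≅ diagram B :=
    { hom := γ
      inv := δ
      hom_inv_id := (isFlag A).hom_ext (isFlag A) (by
        rw [NatTrans.comp_app, hγ, hδ, α.hom_inv_id, NatTrans.id_app])
      inv_hom_id := (isFlag B).hom_ext (isFlag B) (by
        rw [NatTrans.comp_app, hγ, hδ, α.inv_hom_id, NatTrans.id_app]) }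
  exact ⟨⟨ObjectProperty.isoMk _ e⟩, hγ⟩

/-- This lemma and the next two speak of bare morphisms of `C` because they are applied to squares
of restricted flags, whose entries agree with those of the original flag only by unfolding. -/
theorem comp_square_paste {X₁ X₂ X₃ Y₁ Y₂ Y₃ : C} {a : X₁ ⟶ X₂} {b : X₂ ⟶ X₃} {c : X₁ ⟶ X₃}
    {a' : Y₁ ⟶ Y₂} {b' : Y₂ ⟶ Y₃} {c' : Y₁ ⟶ Y₃} {α₁ : X₁ ⟶ Y₁} {α₂ : X₂ ⟶ Y₂} {α₃ : X₃ ⟶ Y₃}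
    (h : a ≫ b = c) (h' : a' ≫ b' = c') (w₁ : a ≫ α₂ = α₁ ≫ a') (w₂ : b ≫ α₃ = α₂ ≫ b') :
    c ≫ α₃ = α₁ ≫ c' := by
  rw [← h, ← h', Category.assoc, w₂, reassoc_of% w₁]

variable [HasZeroMorphisms C]

theorem comp_comp_eq_zero {X X' Y Y' Q : C} {c : X ⟶ Y} {c' : X' ⟶ Y'} {α : Y ⟶ Y'} {β : X ⟶ X'}
    {q : Y' ⟶ Q} (w : c ≫ α = β ≫ c') (h : c' ≫ q = 0) : c ≫ α ≫ q = 0 := by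
  rw [reassoc_of% w, h, comp_zero]

theorem comp_comp_eq_zero' {X Y Y' Q Q' : C} {c : X ⟶ Y} {α : Y ⟶ Y'} {q : Y ⟶ Q} {q' : Y' ⟶ Q'}
    {β : Q ⟶ Q'} (w : q ≫ β = α ≫ q') (h : c ≫ q = 0) : c ≫ α ≫ q' = 0 := by
  rw [← w, reassoc_of% h, zero_comp]

theorem hor_comp_ver_eq_zero (hZ : IsZero Z) (A : S Z n) {i j k : Fin (n + 1)}
    (hij : i ≤ j) (hjk : j ≤ k) : hor (diagram A) hij hjk ≫ ver (diagram A) hij hjk = 0 :=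
  (isFlag A).hor_comp_ver_eq_zero hZ hij hjk

theorem exists_hom_two (hZ : IsZero Z) {A B : S Z 2}
    (α : (diagram A).obj (Shape.top 2) ≅ (diagram B).obj (Shape.top 2))
    (β : (diagram A).obj ⟨(0, 1), by decide⟩ ≅ (diagram B).obj ⟨(0, 1), by decide⟩)
    (h : hor (diagram A) (i := 0) (j := 1) (k := 2) (by decide) (by decide) ≫ α.hom =
      β.hom ≫ hor (diagram B) (i := 0) (j := 1) (k := 2) (by decide) (by decide)) :
    ∃ f : A ⟶ B, (comp f (Shape.top 2)).hom = α.hom ∧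
      (comp f ⟨(0, 1), by decide⟩).hom = β.hom := by
  have h' : hor (diagram B) (i := 0) (j := 1) (k := 2) (by decide) (by decide) ≫ α.inv =
      β.inv ≫ hor (diagram A) (i := 0) (j := 1) (k := 2) (by decide) (by decide) := by
    rw [Iso.comp_inv_eq, Category.assoc, h, Iso.inv_hom_id_assoc]
  obtain ⟨f, hf⟩ := exists_hom hZ (A := A) (B := B) α
    (fun j => match j with
      | 0 => (isZero_diag A hZ 0).eq_of_src _ _
      | 1 => comp_comp_eq_zero h (hor_comp_ver_eq_zero hZ B _ _)
      | 2 => (isZero_diag B hZ 2).eq_of_tgt _ _)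
    (fun j => match j with
      | 0 => (isZero_diag B hZ 0).eq_of_src _ _
      | 1 => comp_comp_eq_zero h' (hor_comp_ver_eq_zero hZ A _ _)
      | 2 => (isZero_diag A hZ 2).eq_of_tgt _ _)
  refine ⟨f, hf, ?_⟩
  have := (isFlag B).mono (i := 0) (j := 1) (k := 2) (by decide) (by decide)
  refine (cancel_mono (hor (diagram B) (i := 0) (j := 1) (k := 2) _ _)).1 ?_
  rw [← comp_hor, ← h]
  exact congrArg (_ ≫ ·) hf

/-- The map `g` on the part `{0, 2, 3}` preserves `A_{02}`. It preserves `A_{01}` as well, because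
on `A_{02}` it agrees with `f`, a map of the part `{0, 1, 2}`. -/
theorem left_zero (hZ : IsZero Z) {A B : S Z 3} (f : (face Z 3).obj A ⟶ (face Z 3).obj B)
    (g : (face Z 1).obj A ⟶ (face Z 1).obj B)
    (w : (comp f (Shape.top 2)).hom = (comp g ⟨(0, 1), by decide⟩).hom) (j : Fin 4) :
    hor (diagram A) (Fin.zero_le j) (Fin.le_last j) ≫ (comp g (Shape.top 2)).hom ≫
      ver (diagram B) (Fin.zero_le j) (Fin.le_last j) = 0 := by
  have eg := comp_hor g (i := 0) (j := 1) (k := 2) (by decide) (by decide)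
  match j with
  | 0 => exact (isZero_diag A hZ 0).eq_of_src _ _
  | 3 => exact (isZero_diag B hZ 3).eq_of_tgt _ _
  | 1 =>
    have ef := comp_hor f (i := 0) (j := 1) (k := 2) (by decide) (by decide)
    have e : _ = (comp f ⟨(0, 1), by decide⟩).hom ≫ _ := comp_square_paste
      (hor_comp_hor (diagram A) (i := 0) (j := 1) (k := 2) (l := 3) (by decide) (by decide)
        (by decide))
      (hor_comp_hor (diagram B) (i := 0) (j := 1) (k := 2) (l := 3) (by decide) (by decide)
        (by decide)) ef ((eg.trans (congrArg (· ≫ _) w.symm)))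
    exact comp_comp_eq_zero e (hor_comp_ver_eq_zero hZ B (i := 0) (j := 1) (k := 3) _ _)
  | 2 => exact comp_comp_eq_zero eg (hor_comp_ver_eq_zero hZ B (i := 0) (j := 2) (k := 3) _ _)

/-- The map `g` on the part `{0, 1, 3}` preserves `A_{01}`. It induces on `A_{13}` the map `f` of
the part `{1, 2, 3}`, hence is compatible with the quotients `A_{23}`, whose kernel is `A_{02}`. -/
theorem right_zero (hZ : IsZero Z) {A B : S Z 3} (f : (face Z 0).obj A ⟶ (face Z 0).obj B)
    (g : (face Z 2).obj A ⟶ (face Z 2).obj B)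
    (w : (comp f (Shape.top 2)).hom = (comp g ⟨(1, 2), by decide⟩).hom) (j : Fin 4) :
    hor (diagram A) (Fin.zero_le j) (Fin.le_last j) ≫ (comp g (Shape.top 2)).hom ≫
      ver (diagram B) (Fin.zero_le j) (Fin.le_last j) = 0 := by
  match j with
  | 0 => exact (isZero_diag A hZ 0).eq_of_src _ _
  | 3 => exact (isZero_diag B hZ 3).eq_of_tgt _ _
  | 1 =>
    have eg := comp_hor g (i := 0) (j := 1) (k := 2) (by decide) (by decide)
    exact comp_comp_eq_zero eg (hor_comp_ver_eq_zero hZ B (i := 0) (j := 1) (k := 3) _ _)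
  | 2 =>
    have eg := comp_ver g (i := 0) (j := 1) (k := 2) (by decide) (by decide)
    have ef := comp_ver f (i := 0) (j := 1) (k := 2) (by decide) (by decide)
    have e : _ = (comp g (Shape.top 2)).hom ≫ _ := comp_square_paste
      (ver_comp_ver (diagram A) (i := 0) (j := 1) (k := 2) (l := 3) (by decide) (by decide)
        (by decide))
      (ver_comp_ver (diagram B) (i := 0) (j := 1) (k := 2) (l := 3) (by decide) (by decide)
        (by decide)) eg (ef.trans (congrArg (· ≫ _) w))
    exact comp_comp_eq_zero' e (hor_comp_ver_eq_zero hZ A (i := 0) (j := 2) (k := 3) _ _)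

theorem exists_hom_left (hZ : IsZero Z) {A B : S Z 3} (f : (face Z 3).obj A ⟶ (face Z 3).obj B)
    (g : (face Z 1).obj A ⟶ (face Z 1).obj B)
    (w : (comp f (Shape.top 2)).hom = (comp g ⟨(0, 1), by decide⟩).hom) :
    ∃ h : A ⟶ B, (face Z 3).map h = f ∧ (face Z 1).map h = g := by
  -- The extension has to respect the filtrations in both directions, so `left_zero` is also needed
  -- for the inverses.
  have w' : (comp (Groupoid.inv f) (Shape.top 2)).hom =
      (comp (Groupoid.inv g) ⟨(0, 1), by decide⟩).hom :=
    congrArg Iso.inv (Iso.ext (α := comp f (Shape.top 2)) (β := comp g ⟨(0, 1), by decide⟩) w)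
  obtain ⟨h, hh⟩ := exists_hom hZ (A := A) (B := B) (comp g (Shape.top 2))
    (left_zero hZ f g w) (left_zero hZ (Groupoid.inv f) (Groupoid.inv g) w')
  have hg : (face Z 1).map h = g := hom_ext hh
  subst hg
  exact ⟨h, hom_ext w.symm, rfl⟩

theorem exists_hom_right (hZ : IsZero Z) {A B : S Z 3} (f : (face Z 0).obj A ⟶ (face Z 0).obj B)
    (g : (face Z 2).obj A ⟶ (face Z 2).obj B)
    (w : (comp f (Shape.top 2)).hom = (comp g ⟨(1, 2), by decide⟩).hom) :
    ∃ h : A ⟶ B, (face Z 0).map h = f ∧ (face Z 2).map h = g := by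
  have w' : (comp (Groupoid.inv f) (Shape.top 2)).hom =
      (comp (Groupoid.inv g) ⟨(1, 2), by decide⟩).hom :=
    congrArg Iso.inv (Iso.ext (α := comp f (Shape.top 2)) (β := comp g ⟨(1, 2), by decide⟩) w)
  obtain ⟨h, hh⟩ := exists_hom hZ (A := A) (B := B) (comp g (Shape.top 2))
    (right_zero hZ f g w) (right_zero hZ (Groupoid.inv f) (Groupoid.inv g) w')
  have hg : (face Z 2).map h = g := hom_ext hh
  subst hg
  exact ⟨h, hom_ext w.symm, rfl⟩

/-- With `B` indexed by `{0, 1, 2}` and `D` by `{0, 2, 3}`, the chain is `0 ↪ B_{01} ↪ B_{02} ≅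
D_{02} ↪ D_{03}`, the isomorphism being given by `φ`. -/
theorem exists_flag_left (hC : IsProtoAbelian C) (hZ : IsZero Z) {B D : S Z 2}
    (φ : (face Z 1).obj B ⟶ (face Z 2).obj D) :
    ∃ (A : S Z 3) (f : (face Z 3).obj A ⟶ B) (g : (face Z 1).obj A ⟶ D),
      (comp f (Shape.top 2)).hom ≫ (comp φ (Shape.top 1)).hom =
        (comp g ⟨(0, 1), by decide⟩).hom := by
  obtain ⟨φ₁, hφ⟩ : ∃ φ₁ : (diagram B).obj (Shape.top 2) ≅
      (diagram D).obj ⟨(0, 1), by decide⟩, φ₁ = comp φ (Shape.top 1) := ⟨_, rfl⟩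
  let b := hor (diagram B) (i := 0) (j := 1) (k := 2) (by decide) (by decide)
  let d := hor (diagram D) (i := 0) (j := 1) (k := 2) (by decide) (by decide)
  have hb : Mono b := (isFlag B).mono _ _
  have hd : Mono d := (isFlag D).mono _ _
  let X : Fin 4 → Over ((diagram D).obj (Shape.top 2)) :=
    ![Over.mk (0 : Z ⟶ _), Over.mk (b ≫ φ₁.hom ≫ d), Over.mk (φ₁.hom ≫ d), Over.mk (𝟙 _)]
  have hX : ∀ j, Mono (X j).hom
    | 0 => ⟨fun _ _ _ => hZ.eq_of_tgt _ _⟩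
    | 1 => inferInstanceAs (Mono (b ≫ φ₁.hom ≫ d))
    | 2 => inferInstanceAs (Mono (φ₁.hom ≫ d))
    | 3 => inferInstanceAs (Mono (𝟙 _))
  have hle : ∀ i j, i ≤ j → Nonempty (X i ⟶ X j)
    | 0, 0, _ => ⟨𝟙 _⟩
    | 0, 1, _ => ⟨Over.homMk 0 (hZ.eq_of_src _ _)⟩
    | 0, 2, _ => ⟨Over.homMk 0 (hZ.eq_of_src _ _)⟩
    | 0, 3, _ => ⟨Over.homMk 0 (hZ.eq_of_src _ _)⟩
    | 1, 1, _ => ⟨𝟙 _⟩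
    | 1, 2, _ => ⟨Over.homMk b rfl⟩
    | 1, 3, _ => ⟨Over.homMk (b ≫ φ₁.hom ≫ d) (Category.comp_id _)⟩
    | 2, 2, _ => ⟨𝟙 _⟩
    | 2, 3, _ => ⟨Over.homMk (φ₁.hom ≫ d) (Category.comp_id _)⟩
    | 3, 3, _ => ⟨𝟙 _⟩
  obtain ⟨A, hA, e, he⟩ := exists_isFlag_of_chain hC hZ X hX hle hZ
  let e₁ : A.obj ⟨(0, 1), by decide⟩ ≅ (diagram B).obj ⟨(0, 1), by decide⟩ := e 1
  let e₂ : A.obj ⟨(0, 2), by decide⟩ ≅ (diagram B).obj (Shape.top 2) := e 2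
  let e₃ : A.obj ⟨(0, 3), by decide⟩ ≅ (diagram D).obj (Shape.top 2) := e 3
  have h12 : e₁.hom ≫ b ≫ φ₁.hom ≫ d =
      hor A (i := 0) (j := 1) (k := 2) (by decide) (by decide) ≫ e₂.hom ≫ φ₁.hom ≫ d :=
    he 1 2 (by decide)
  have h23 : e₂.hom ≫ φ₁.hom ≫ d =
      hor A (i := 0) (j := 2) (k := 3) (by decide) (by decide) ≫ e₃.hom ≫ 𝟙 _ :=
    he 2 3 (by decide)
  have h12' : hor A (i := 0) (j := 1) (k := 2) (by decide) (by decide) ≫ e₂.hom = e₁.hom ≫ b := by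
    rw [← cancel_mono (φ₁.hom ≫ d), Category.assoc, Category.assoc, h12]
  have h23' : hor A (i := 0) (j := 2) (k := 3) (by decide) (by decide) ≫ e₃.hom =
      (e₂ ≪≫ φ₁).hom ≫ d := by
    rw [Iso.trans_hom, Category.assoc, h23, Category.comp_id]
  obtain ⟨f, hf, -⟩ := exists_hom_two hZ (A := (face Z 3).obj (ofDiagram hA)) (B := B) e₂ e₁ h12'
  obtain ⟨g, -, hg⟩ := exists_hom_two hZ (A := (face Z 1).obj (ofDiagram hA)) (B := D) e₃
    (e₂ ≪≫ φ₁) h23'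
  refine ⟨ofDiagram hA, f, g, ?_⟩
  refine (congrArg (· ≫ _) hf).trans (Eq.trans ?_ hg.symm)
  rw [hφ]; rfl

/-- With `B` indexed by `{0, 1, 3}` and `D` by `{1, 2, 3}`, the chain is `0 ↪ B_{01} ↪ P ↪ B_{03}`,
where `P` is the preimage of `D_{12}` under the map from `B_{03}` to `B_{13} ≅ D_{13}`. -/
theorem exists_flag_right (hC : IsProtoAbelian C) (hZ : IsZero Z) {B D : S Z 2}
    (φ : (face Z 1).obj D ⟶ (face Z 0).obj B) :
    ∃ (A : S Z 3) (f : (face Z 0).obj A ⟶ D) (g : (face Z 2).obj A ⟶ B),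
      (comp f (Shape.top 2)).hom ≫ (comp φ (Shape.top 1)).hom =
        (comp g ⟨(1, 2), by decide⟩).hom := by
  obtain ⟨φ₁, hφ⟩ : ∃ φ₁ : (diagram D).obj (Shape.top 2) ≅
      (diagram B).obj ⟨(1, 2), by decide⟩, φ₁ = comp φ (Shape.top 1) := ⟨_, rfl⟩
  let b := hor (diagram B) (i := 0) (j := 1) (k := 2) (by decide) (by decide)
  let b' := ver (diagram B) (i := 0) (j := 1) (k := 2) (by decide) (by decide)
  let d := hor (diagram D) (i := 0) (j := 1) (k := 2) (by decide) (by decide)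
  let d' := ver (diagram D) (i := 0) (j := 1) (k := 2) (by decide) (by decide)
  have hbb : b ≫ b' = 0 := hor_comp_ver_eq_zero hZ B _ _
  have hdd : d ≫ d' = 0 := hor_comp_ver_eq_zero hZ D _ _
  have hb : Mono b := (isFlag B).mono _ _
  have hb' : Epi b' := (isFlag B).epi _ _
  have hd : Mono d := (isFlag D).mono _ _
  obtain ⟨P, i, p, hi, hp, hP⟩ := hC.exists_isPullback b' (d ≫ φ₁.hom)
  let X : Fin 4 → Over ((diagram B).obj (Shape.top 2)) :=
    ![Over.mk (0 : Z ⟶ _), Over.mk b, Over.mk i, Over.mk (𝟙 _)]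
  have hX : ∀ j, Mono (X j).hom
    | 0 => ⟨fun _ _ _ => hZ.eq_of_tgt _ _⟩
    | 1 => hb
    | 2 => hi
    | 3 => inferInstanceAs (Mono (𝟙 _))
  have hle : ∀ i j, i ≤ j → Nonempty (X i ⟶ X j)
    | 0, 0, _ => ⟨𝟙 _⟩
    | 0, 1, _ => ⟨Over.homMk 0 (hZ.eq_of_src _ _)⟩
    | 0, 2, _ => ⟨Over.homMk 0 (hZ.eq_of_src _ _)⟩
    | 0, 3, _ => ⟨Over.homMk 0 (hZ.eq_of_src _ _)⟩
    | 1, 1, _ => ⟨𝟙 _⟩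
    | 1, 2, _ => ⟨Over.homMk (hP.lift b 0 (hbb.trans zero_comp.symm)) (hP.lift_fst _ _ _)⟩
    | 1, 3, _ => ⟨Over.homMk b (Category.comp_id _)⟩
    | 2, 2, _ => ⟨𝟙 _⟩
    | 2, 3, _ => ⟨Over.homMk i (Category.comp_id _)⟩
    | 3, 3, _ => ⟨𝟙 _⟩
  obtain ⟨A, hA, e, he⟩ := exists_isFlag_of_chain hC hZ X hX hle hZ
  let e₁ : A.obj ⟨(0, 1), by decide⟩ ≅ (diagram B).obj ⟨(0, 1), by decide⟩ := e 1
  let e₂ : A.obj ⟨(0, 2), by decide⟩ ≅ P := e 2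
  let e₃ : A.obj ⟨(0, 3), by decide⟩ ≅ (diagram B).obj (Shape.top 2) := e 3
  have h13 : e₁.hom ≫ b =
      hor A (i := 0) (j := 1) (k := 3) (by decide) (by decide) ≫ e₃.hom ≫ 𝟙 _ :=
    he 1 3 (by decide)
  have h23 : e₂.hom ≫ i =
      hor A (i := 0) (j := 2) (k := 3) (by decide) (by decide) ≫ e₃.hom ≫ 𝟙 _ :=
    he 2 3 (by decide)
  rw [Category.comp_id] at h13 h23
  obtain ⟨g, hg, -⟩ := exists_hom_two hZ (A := (face Z 2).obj (ofDiagram hA)) (B := B) e₃ e₁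
    h13.symm
  obtain ⟨g₁, hg₁⟩ : ∃ g₁ : A.obj ⟨(1, 3), by decide⟩ ≅ (diagram B).obj ⟨(1, 2), by decide⟩,
      g₁ = comp g ⟨(1, 2), by decide⟩ := ⟨_, rfl⟩
  have hgv : ver A (i := 0) (j := 1) (k := 3) (by decide) (by decide) ≫ g₁.hom =
      e₃.hom ≫ b' := by
    rw [hg₁]
    exact (comp_ver g (i := 0) (j := 1) (k := 2) (by decide) (by decide)).trans
      (congrArg (· ≫ _) hg)
  have hAe := hA.epi (i := 0) (j := 1) (k := 2) (by decide) (by decide)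
  -- On `A_{13}` the map `f` must be the one induced by `g`, followed by the inverse of `φ`. What
  -- remains is that it matches the subobjects `A_{12}` and `D_{12}`, in both directions.
  obtain ⟨f, hf⟩ := exists_hom hZ (A := (face Z 0).obj (ofDiagram hA)) (B := D) (g₁ ≪≫ φ₁.symm)
    (fun j => match j with
      | 0 => (isZero_diag _ hZ 0).eq_of_src _ _
      | 1 => by
        change hor A (i := 1) (j := 2) (k := 3) (by decide) (by decide) ≫ (g₁.hom ≫ φ₁.inv) ≫
          d' = 0
        -- Testing on `A_{02} ≅ P` suffices, as it covers `A_{12}`; by the pullback square it lands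
        -- in `D_{12}`, which dies in `D_{23}`.
        refine (cancel_epi (ver A (i := 0) (j := 1) (k := 2) _ _)).1 ?_
        rw [← hor_comp_ver_assoc, Category.assoc, reassoc_of% hgv, ← reassoc_of% h23,
          reassoc_of% hP.w, Iso.hom_inv_id_assoc, hdd, comp_zero, comp_zero, comp_zero]
      | 2 => (isZero_diag _ hZ 2).eq_of_tgt _ _)
    (fun j => match j with
      | 0 => (isZero_diag _ hZ 0).eq_of_src _ _
      | 1 => by
        change d ≫ (φ₁.hom ≫ g₁.inv) ≫
          ver A (i := 1) (j := 2) (k := 3) (by decide) (by decide) = 0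
        have h1 : b' ≫ g₁.inv =
            e₃.inv ≫ ver A (i := 0) (j := 1) (k := 3) (by decide) (by decide) := by
          rw [Iso.comp_inv_eq, Category.assoc, hgv, Iso.inv_hom_id_assoc]
        have h2 : i ≫ e₃.inv =
            e₂.inv ≫ hor A (i := 0) (j := 2) (k := 3) (by decide) (by decide) := by
          rw [Iso.comp_inv_eq, Category.assoc, ← h23, Iso.inv_hom_id_assoc]
        have h3 := hP.w
        -- Here `P` covers `D_{12}` by `p`, and the composite factors through `A_{02}`, which dies
        -- in `A_{23}`.
        rw [← cancel_epi p, Category.assoc, ← reassoc_of% h3,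
          reassoc_of% h1, reassoc_of% h2, ver_comp_ver, hA.hor_comp_ver_eq_zero hZ,
          comp_zero, comp_zero]
      | 2 => (isZero_diag _ hZ 2).eq_of_tgt _ _)
  refine ⟨ofDiagram hA, f, g, ?_⟩
  have hgφ : (g₁.hom ≫ φ₁.inv) ≫ φ₁.hom = g₁.hom := by simp
  refine (congrArg (· ≫ _) hf).trans (Eq.trans ?_ (congrArg Iso.hom hg₁))
  rw [← hφ]
  exact hgφ

end

end Flag

/-- A criterion for the first projection of a 2-pullback to be an equivalence. -/
theorem TwoPullback.isEquivalence_fst {X Y B : Type*} [Category X] [Category Y] [Category B]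
    (R : X ⥤ B) (L : Y ⥤ B) (hsurj : ∀ x, ∃ y, Nonempty (R.obj x ≅ L.obj y))
    (hfaithful : ∀ (x : X) (y y' : Y) (_ : R.obj x ≅ L.obj y) (f g : y ⟶ y'),
      L.map f = L.map g → f = g)
    (hfull : ∀ (x x' : X) (y y' : Y) (i : R.obj x ≅ L.obj y) (i' : R.obj x' ≅ L.obj y')
      (h : x ⟶ x'), ∃ f : y ⟶ y', L.map f = i.inv ≫ R.map h ≫ i'.hom) :
    (CategoricalPullback.π₁ R L).IsEquivalence where
  faithful := ⟨fun {x y f g} h => by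
    have h1 : f.fst = g.fst := h
    refine CategoricalPullback.hom_ext h1 (hfaithful x.fst _ _ x.iso _ _ ?_)
    rw [← cancel_epi x.iso.hom, ← f.w, ← g.w, h1]⟩
  full := ⟨fun {x y} h => by
    obtain ⟨f, hf⟩ := hfull _ _ _ _ x.iso y.iso h
    exact ⟨⟨h, f, by rw [hf, Iso.hom_inv_id_assoc]⟩, rfl⟩⟩
  essSurj := ⟨fun x => by
    obtain ⟨y, ⟨i⟩⟩ := hsurj x
    exact ⟨⟨x, y, i⟩, ⟨Iso.refl _⟩⟩⟩

/-! ### The 2-Segal equivalences and associativity -/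

namespace Flag

section

variable {C : Type u} [Category.{v} C] {Z : C} {n : ℕ}

theorem map_comp_map_eq (A : Shape n ⥤ C) {p q r s : Shape n} (f : p ⟶ q) (g : q ⟶ s)
    (f' : p ⟶ r) (g' : r ⟶ s) : A.map f ≫ A.map g = A.map f' ≫ A.map g' := by
  rw [← A.map_comp, ← A.map_comp]
  rfl

/-- The isomorphism between iterated faces given by a simplicial identity. -/
def faceFace {a c : Fin (n + 3)} {b d : Fin (n + 2)}
    (h : (Fin.succAboveOrderEmb a).toOrderHom.comp (Fin.succAboveOrderEmb b).toOrderHom =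
      (Fin.succAboveOrderEmb c).toOrderHom.comp (Fin.succAboveOrderEmb d).toOrderHom)
    (A : S Z (n + 2)) :
    (face Z b).obj ((face Z a).obj A) ⟶ (face Z d).obj ((face Z c).obj A) :=
  ⟨ObjectProperty.isoMk _ (NatIso.ofComponents
    (fun p => (diagram A).mapIso (eqToIso (congrArg (fun φ => Shape.map φ p) h)))
    (fun {p q} _ => map_comp_map_eq (diagram A) _
      (eqToHom (congrArg (fun φ => Shape.map φ q) h))
      (eqToHom (congrArg (fun φ => Shape.map φ p) h)) _))⟩

theorem faceFace_naturality {a c : Fin (n + 3)} {b d : Fin (n + 2)}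
    (h : (Fin.succAboveOrderEmb a).toOrderHom.comp (Fin.succAboveOrderEmb b).toOrderHom =
      (Fin.succAboveOrderEmb c).toOrderHom.comp (Fin.succAboveOrderEmb d).toOrderHom)
    {A B : S Z (n + 2)} (f : A ⟶ B) :
    (face Z b).map ((face Z a).map f) ≫ faceFace h B =
      faceFace h A ≫ (face Z d).map ((face Z c).map f) :=
  hom_ext ((CoreHom.iso f).hom.hom.naturality
    (eqToHom (congrArg (fun φ => Shape.map φ (Shape.top n)) h))).symm

/-- The 2-cell of the square formed by the restrictions to `{0, 1, 2}` and `{0, 2, 3}`. -/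
def leftHom (A : S Z 3) :
    (face Z (n := 1) 1).obj ((face Z 3).obj A) ⟶ (face Z 2).obj ((face Z 1).obj A) :=
  faceFace (by decide) A

/-- The 2-cell of the square formed by the restrictions to `{1, 2, 3}` and `{0, 1, 3}`. -/
def rightHom (A : S Z 3) :
    (face Z (n := 1) 1).obj ((face Z 0).obj A) ⟶ (face Z 0).obj ((face Z 2).obj A) :=
  faceFace (by decide) A

theorem comp_leftHom (A : S Z 3) : (comp (leftHom A) (Shape.top 1)).hom =
    𝟙 ((diagram A).obj ⟨(0, 2), by decide⟩) :=
  (diagram A).map_id ⟨(0, 2), by decide⟩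

theorem comp_rightHom (A : S Z 3) : (comp (rightHom A) (Shape.top 1)).hom =
    𝟙 ((diagram A).obj ⟨(1, 3), by decide⟩) :=
  (diagram A).map_id ⟨(1, 3), by decide⟩

theorem leftHom_naturality {A B : S Z 3} (f : A ⟶ B) :
    (face Z 1).map ((face Z 3).map f) ≫ leftHom B =
      leftHom A ≫ (face Z 2).map ((face Z 1).map f) :=
  faceFace_naturality _ f

theorem rightHom_naturality {A B : S Z 3} (f : A ⟶ B) :
    (face Z 1).map ((face Z 0).map f) ≫ rightHom B =
      rightHom A ≫ (face Z 0).map ((face Z 2).map f) :=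
  faceFace_naturality _ f

-- From here on only naturality and the identity component on the total object matter.
attribute [irreducible] leftHom rightHom

theorem comp_comp_leftHom {A : S Z 3} {B : S Z 1}
    (f : B ⟶ (face Z 1).obj ((face Z 3).obj A)) :
    (comp (f ≫ leftHom A) (Shape.top 1)).hom = (comp f (Shape.top 1)).hom :=
  (congrArg (_ ≫ ·) (comp_leftHom A)).trans (Category.comp_id _)

theorem comp_leftHom_comp {A : S Z 3} {B : S Z 1}
    (f : (face Z 2).obj ((face Z 1).obj A) ⟶ B) :
    (comp (leftHom A ≫ f) (Shape.top 1)).hom = (comp f (Shape.top 1)).hom :=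
  (congrArg (· ≫ _) (comp_leftHom A)).trans (Category.id_comp _)

theorem comp_comp_rightHom {A : S Z 3} {B : S Z 1}
    (f : B ⟶ (face Z 1).obj ((face Z 0).obj A)) :
    (comp (f ≫ rightHom A) (Shape.top 1)).hom = (comp f (Shape.top 1)).hom :=
  (congrArg (_ ≫ ·) (comp_rightHom A)).trans (Category.comp_id _)

theorem comp_rightHom_comp {A : S Z 3} {B : S Z 1}
    (f : (face Z 0).obj ((face Z 2).obj A) ⟶ B) :
    (comp (rightHom A ≫ f) (Shape.top 1)).hom = (comp f (Shape.top 1)).hom :=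
  (congrArg (· ≫ _) (comp_rightHom A)).trans (Category.id_comp _)

/-- The functor from flags of length three to pairs of flags of length two, given by the parts on
`{0, 1, 2}` and `{0, 2, 3}`. -/
def toPullbackLeft (Z : C) : S Z 3 ⥤ CategoricalPullback
    ((face Z (n := 1) 1).prod (𝟭 (S Z 1))) (Functor.prod' (face Z (n := 1) 2) (face Z 0)) where
  obj A := ⟨((face Z 3).obj A, (face Z 0).obj ((face Z 1).obj A)), (face Z 1).obj A,
    Iso.prod ((Groupoid.isoEquivHom _ _).symm (leftHom A)) (Iso.refl _)⟩
  map f := ⟨(face Z 3).map f ×ₘ (face Z 0).map ((face Z 1).map f), (face Z 1).map f,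
    CategoryTheory.Prod.hom_ext (leftHom_naturality f)
      ((Category.comp_id _).trans (Category.id_comp _).symm)⟩
  map_id A := CategoricalPullback.hom_ext (CategoryTheory.Prod.hom_ext ((face Z 3).map_id A)
    ((congrArg (face Z 0).map ((face Z 1).map_id A)).trans ((face Z 0).map_id _)))
    ((face Z 1).map_id A)
  map_comp f g := CategoricalPullback.hom_ext
    (CategoryTheory.Prod.hom_ext ((face Z 3).map_comp f g)
      ((congrArg (face Z 0).map ((face Z 1).map_comp f g)).trans ((face Z 0).map_comp _ _)))
    ((face Z 1).map_comp f g)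

/-- The functor from flags of length three to pairs of flags of length two, given by the parts on
`{1, 2, 3}` and `{0, 1, 3}`. -/
def toPullbackRight (Z : C) : S Z 3 ⥤ CategoricalPullback
    ((𝟭 (S Z 1)).prod (face Z (n := 1) 1)) (Functor.prod' (face Z (n := 1) 2) (face Z 0)) where
  obj A := ⟨((face Z 2).obj ((face Z 2).obj A), (face Z 0).obj A), (face Z 2).obj A,
    Iso.prod (Iso.refl _) ((Groupoid.isoEquivHom _ _).symm (rightHom A))⟩
  map f := ⟨(face Z 2).map ((face Z 2).map f) ×ₘ (face Z 0).map f, (face Z 2).map f,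
    CategoryTheory.Prod.hom_ext ((Category.comp_id _).trans (Category.id_comp _).symm)
      (rightHom_naturality f)⟩
  map_id A := CategoricalPullback.hom_ext (CategoryTheory.Prod.hom_ext
    ((congrArg (face Z 2).map ((face Z 2).map_id A)).trans ((face Z 2).map_id _))
    ((face Z 0).map_id A)) ((face Z 2).map_id A)
  map_comp f g := CategoricalPullback.hom_ext (CategoryTheory.Prod.hom_ext
    ((congrArg (face Z 2).map ((face Z 2).map_comp f g)).trans ((face Z 2).map_comp _ _))
    ((face Z 0).map_comp f g)) ((face Z 2).map_comp f g)

theorem toPullbackLeft_faithful : (toPullbackLeft Z).Faithful :=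
  ⟨fun {A B f g} h => by
    have h1 : (face Z 1).map f = (face Z 1).map g := congrArg CategoricalPullback.Hom.snd h
    exact hom_ext (congrArg (fun k => (comp k (Shape.top 2)).hom) h1)⟩

theorem toPullbackRight_faithful : (toPullbackRight Z).Faithful :=
  ⟨fun {A B f g} h => by
    have h1 : (face Z 2).map f = (face Z 2).map g := congrArg CategoricalPullback.Hom.snd h
    exact hom_ext (congrArg (fun k => (comp k (Shape.top 2)).hom) h1)⟩

variable [HasZeroMorphisms C]

theorem exists_map_eq_left (hZ : IsZero Z) {A B : S Z 3}
    (f : (face Z 3).obj A ⟶ (face Z 3).obj B) (g : (face Z 1).obj A ⟶ (face Z 1).obj B)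
    (w : (face Z 1).map f ≫ leftHom B = leftHom A ≫ (face Z 2).map g) :
    ∃ h : A ⟶ B, (face Z 3).map h = f ∧ (face Z 1).map h = g := by
  have e := congrArg (fun x => (comp x (Shape.top 1)).hom) w
  exact exists_hom_left hZ f g ((comp_comp_leftHom ((face Z 1).map f)).symm.trans
    (e.trans (comp_leftHom_comp ((face Z 2).map g))))

theorem toPullbackLeft_full (hZ : IsZero Z) : (toPullbackLeft Z).Full :=
  ⟨fun {A B} k => by
    have w := congrArg (fun x => x.1) k.w
    have w' := congrArg (fun x => x.2) k.w
    obtain ⟨h, h1, h2⟩ := exists_map_eq_left hZ (A := A) (B := B) k.fst.1 k.snd w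
    have e : (face Z 0).map ((face Z 1).map h) = k.fst.2 := by
      rw [h2]
      exact (Category.id_comp _).symm.trans (w'.symm.trans (Category.comp_id _))
    exact ⟨h, CategoricalPullback.hom_ext (CategoryTheory.Prod.hom_ext h1 e) h2⟩⟩

/-- The flags `B` and `D` are glued by `exists_flag_left`. The third datum `E` adds nothing, since
the 2-cell identifies it with the `{2, 3}` part of `D`. -/
theorem toPullbackLeft_essSurj (hC : IsProtoAbelian C) (hZ : IsZero Z) :
    (toPullbackLeft Z).EssSurj :=
  ⟨fun x => by
    obtain ⟨⟨B, E⟩, D, i⟩ := x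
    let φ : (face Z 1).obj B ⟶ (face Z 2).obj D := i.hom.1
    let ψ : E ⟶ (face Z 0).obj D := i.hom.2
    let ψ' : (face Z 0).obj D ⟶ E := i.inv.2
    have hψ : ψ' ≫ ψ = 𝟙 _ := congrArg (fun x => x.2) i.inv_hom_id
    obtain ⟨A, f, g, h⟩ := exists_flag_left hC hZ φ
    have h1 : (face Z 1).map f ≫ φ = leftHom A ≫ (face Z 2).map g :=
      hom_ext (h.trans (comp_leftHom_comp ((face Z 2).map g)).symm)
    have h2 : ((face Z 0).map g ≫ ψ') ≫ ψ = 𝟙 _ ≫ (face Z 0).map g := by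
      rw [Category.assoc, hψ, Category.comp_id, Category.id_comp]
    exact ⟨A, ⟨(Groupoid.isoEquivHom _ _).symm
      ⟨f ×ₘ ((face Z 0).map g ≫ ψ'), g, CategoryTheory.Prod.hom_ext h1 h2⟩⟩⟩⟩

theorem exists_map_eq_right (hZ : IsZero Z) {A B : S Z 3}
    (f : (face Z 0).obj A ⟶ (face Z 0).obj B) (g : (face Z 2).obj A ⟶ (face Z 2).obj B)
    (w : (face Z 1).map f ≫ rightHom B = rightHom A ≫ (face Z 0).map g) :
    ∃ h : A ⟶ B, (face Z 0).map h = f ∧ (face Z 2).map h = g := by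
  have e := congrArg (fun x => (comp x (Shape.top 1)).hom) w
  exact exists_hom_right hZ f g ((comp_comp_rightHom ((face Z 1).map f)).symm.trans
    (e.trans (comp_rightHom_comp ((face Z 0).map g))))

theorem toPullbackRight_full (hZ : IsZero Z) : (toPullbackRight Z).Full :=
  ⟨fun {A B} k => by
    have w := congrArg (fun x => x.2) k.w
    have w' := congrArg (fun x => x.1) k.w
    obtain ⟨h, h1, h2⟩ := exists_map_eq_right hZ (A := A) (B := B) k.fst.2 k.snd w
    have e : (face Z 2).map ((face Z 2).map h) = k.fst.1 := by
      rw [h2]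
      exact (Category.id_comp _).symm.trans (w'.symm.trans (Category.comp_id _))
    exact ⟨h, CategoricalPullback.hom_ext (CategoryTheory.Prod.hom_ext e h1) h2⟩⟩

/-- The flags `B` and `D` are glued by `exists_flag_right`; the 2-cell identifies `E` with the `{0,
1}` part of `B`. -/
theorem toPullbackRight_essSurj (hC : IsProtoAbelian C) (hZ : IsZero Z) :
    (toPullbackRight Z).EssSurj :=
  ⟨fun x => by
    obtain ⟨⟨E, D⟩, B, i⟩ := x
    let φ : (face Z 1).obj D ⟶ (face Z 0).obj B := i.hom.2
    let ψ : E ⟶ (face Z 2).obj B := i.hom.1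
    let ψ' : (face Z 2).obj B ⟶ E := i.inv.1
    have hψ : ψ' ≫ ψ = 𝟙 _ := congrArg (fun x => x.1) i.inv_hom_id
    obtain ⟨A, f, g, h⟩ := exists_flag_right hC hZ φ
    have h1 : (face Z 1).map f ≫ φ = rightHom A ≫ (face Z 0).map g :=
      hom_ext (h.trans (comp_rightHom_comp ((face Z 0).map g)).symm)
    have h2 : ((face Z 2).map g ≫ ψ') ≫ ψ = 𝟙 _ ≫ (face Z 2).map g := by
      rw [Category.assoc, hψ, Category.comp_id, Category.id_comp]
    exact ⟨A, ⟨(Groupoid.isoEquivHom _ _).symm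
      ⟨((face Z 2).map g ≫ ψ') ×ₘ f, g, CategoryTheory.Prod.hom_ext h2 h1⟩⟩⟩⟩

theorem toPullbackLeft_isEquivalence (hC : IsProtoAbelian C) (hZ : IsZero Z) :
    (toPullbackLeft Z).IsEquivalence :=
  { faithful := toPullbackLeft_faithful
    full := toPullbackLeft_full hZ
    essSurj := toPullbackLeft_essSurj hC hZ }

theorem toPullbackRight_isEquivalence (hC : IsProtoAbelian C) (hZ : IsZero Z) :
    (toPullbackRight Z).IsEquivalence :=
  { faithful := toPullbackRight_faithful
    full := toPullbackRight_full hZ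
    essSurj := toPullbackRight_essSurj hC hZ }

open scoped MonoidalCategory

/-- The span `S_1 × S_1 ← S_2 → S_1`. -/
def mulSpan (Z : C) : SpanGrpd.Span (S Z 1 ⊗ S Z 1) (S Z 1) where
  apex := S Z 2
  left := Functor.prod' (face Z 2) (face Z 0)
  right := face Z 1

/-- The span `(S_1 × S_1) × S_1 ← S_3 → S_1`. -/
def tripleSpan (Z : C) : SpanGrpd.Span ((S Z 1 ⊗ S Z 1) ⊗ S Z 1) (S Z 1) where
  apex := S Z 3
  left := Functor.prod' (face Z 3 ⋙ Functor.prod' (face Z 2) (face Z 0)) (face Z 1 ⋙ face Z 0)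
  right := face Z 1 ⋙ face Z 1

theorem mul_assoc (hC : IsProtoAbelian C) (hZ : IsZero Z) :
    mul Z ▷ S Z 1 ≫ mul Z = (α_ (S Z 1) (S Z 1) (S Z 1)).hom ≫ S Z 1 ◁ mul Z ≫ mul Z := by
  have h₁ : (Fin.succAboveOrderEmb (3 : Fin 4)).toOrderHom.comp
      (Fin.succAboveOrderEmb (2 : Fin 3)).toOrderHom = (Fin.succAboveOrderEmb 2).toOrderHom.comp
      (Fin.succAboveOrderEmb 2).toOrderHom := by decide
  have h₂ : (Fin.succAboveOrderEmb (3 : Fin 4)).toOrderHom.comp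
      (Fin.succAboveOrderEmb (0 : Fin 3)).toOrderHom = (Fin.succAboveOrderEmb 0).toOrderHom.comp
      (Fin.succAboveOrderEmb 2).toOrderHom := by decide
  have h₃ : (Fin.succAboveOrderEmb (1 : Fin 4)).toOrderHom.comp
      (Fin.succAboveOrderEmb (0 : Fin 3)).toOrderHom = (Fin.succAboveOrderEmb 0).toOrderHom.comp
      (Fin.succAboveOrderEmb 0).toOrderHom := by decide
  have h₄ : (Fin.succAboveOrderEmb (2 : Fin 4)).toOrderHom.comp
      (Fin.succAboveOrderEmb (1 : Fin 3)).toOrderHom = (Fin.succAboveOrderEmb 1).toOrderHom.comp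
      (Fin.succAboveOrderEmb 1).toOrderHom := by decide
  -- The legs of `tripleSpan` are the iterated faces occurring in this bracketing, so identity
  -- 2-cells suffice.
  have h1 : tripleSpan Z ≈ ((mulSpan Z).prod (SpanGrpd.Span.id (S Z 1))).comp (mulSpan Z) :=
    ⟨toPullbackLeft Z, toPullbackLeft_isEquivalence hC hZ, ⟨Iso.refl _⟩, ⟨Iso.refl _⟩⟩
  -- The other bracketing produces its edges through different iterated faces, so its 2-cells are
  -- simplicial identities. The functor `𝟭 _` on the target adds a trivial composition, removed at
  -- the end by `comp_id`.
  have h2 := SpanGrpd.Span.comp_graph_eq (tripleSpan Z)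
    (((SpanGrpd.Span.id (S Z 1)).prod (mulSpan Z)).comp (mulSpan Z))
    (prod.associativity (S Z 1) (S Z 1) (S Z 1)).functor
    (prod.associativity (S Z 1) (S Z 1) (S Z 1)).isEquivalence_functor (𝟭 _)
    (toPullbackRight Z) (toPullbackRight_isEquivalence hC hZ)
    (NatIso.ofComponents (fun A => Iso.prod
      ((Groupoid.isoEquivHom _ _).symm (faceFace h₁ A))
      (Iso.prod ((Groupoid.isoEquivHom _ _).symm (faceFace h₂ A))
        ((Groupoid.isoEquivHom _ _).symm (faceFace h₃ A))))
      (fun f => CategoryTheory.Prod.hom_ext (faceFace_naturality h₁ f)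
        (CategoryTheory.Prod.hom_ext (faceFace_naturality h₂ f) (faceFace_naturality h₃ f))))
    (NatIso.ofComponents (fun A => (Groupoid.isoEquivHom _ _).symm (faceFace h₄ A))
      (fun f => faceFace_naturality h₄ f))
  exact Quotient.sound (Setoid.trans (Setoid.symm h1)
    (Setoid.trans (Setoid.symm (SpanGrpd.Span.comp_id _)) h2))

end
-- Contractibility of `S_0` and the unit laws
section

variable {C : Type u} [Category.{v} C] {Z : C} {n : ℕ}

open scoped MonoidalCategory

/-- The map is a pushout of `A_{01} ⟶ A_{11}`, a map between zero objects. -/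
theorem isIso_ver_of_isZero (hZ : IsZero Z) (A : S Z 2)
    (h : IsZero ((diagram A).obj ⟨(0, 1), by decide⟩)) :
    IsIso (ver (diagram A) (i := 0) (j := 1) (k := 2) (by decide) (by decide)) := by
  have : IsIso (ver (diagram A) (i := 0) (j := 1) (k := 1) (by decide) le_rfl) :=
    ⟨(isZero_diag A hZ 1).to_ _, h.eq_of_src _ _, (isZero_diag A hZ 1).eq_of_src _ _⟩
  exact ((isFlag A).isPushout (i := 0) (i' := 1) (j := 1) (j' := 2) (by decide) le_rfl
    (by decide)).isIso_inl_of_isIso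

/-- The map is a pullback of `A_{11} ⟶ A_{12}`, a map between zero objects. -/
theorem isIso_hor_of_isZero (hZ : IsZero Z) (A : S Z 2)
    (h : IsZero ((diagram A).obj ⟨(1, 2), by decide⟩)) :
    IsIso (hor (diagram A) (i := 0) (j := 1) (k := 2) (by decide) (by decide)) := by
  have : IsIso (hor (diagram A) (i := 1) (j := 1) (k := 2) le_rfl (by decide)) :=
    ⟨(isZero_diag A hZ 1).from_ _, (isZero_diag A hZ 1).eq_of_src _ _, h.eq_of_src _ _⟩
  exact ((isFlag A).isPullback (i := 0) (i' := 1) (j := 1) (j' := 2) (by decide) le_rfl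
    (by decide)).isIso_fst_of_isIso

theorem hom_eq_of_isZero {A B : S Z n} (h : IsZero ((diagram A).obj (Shape.top n))) (f g : A ⟶ B) :
    f = g :=
  hom_ext (h.eq_of_src _ _)

theorem degeneracy_isZero_zero (hZ : IsZero Z) (A : S Z 1) :
    IsZero ((diagram ((degeneracy Z 0).obj A)).obj ⟨(0, 1), by decide⟩) :=
  isZero_diag A hZ 0

theorem degeneracy_isZero_one (hZ : IsZero Z) (A : S Z 1) :
    IsZero ((diagram ((degeneracy Z 1).obj A)).obj ⟨(1, 2), by decide⟩) :=
  isZero_diag A hZ 1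

theorem degeneracy_isZero (hZ : IsZero Z) (A : S Z 0) :
    IsZero ((diagram ((degeneracy Z 0).obj A)).obj (Shape.top 1)) :=
  isZero_diag A hZ 0

theorem isZero_of_hom {A B : S Z n} (f : A ⟶ B) {p : Shape n} (h : IsZero ((diagram A).obj p)) :
    IsZero ((diagram B).obj p) :=
  h.of_iso (comp f p).symm

theorem hom_eq_of_face_zero (hZ : IsZero Z) {A B : S Z 2}
    (hB : IsZero ((diagram B).obj ⟨(0, 1), by decide⟩)) {f g : A ⟶ B}
    (h : (face Z 0).map f = (face Z 0).map g) : f = g := by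
  have := isIso_ver_of_isZero hZ B hB
  refine hom_ext ?_
  refine (cancel_mono (ver (diagram B) (i := 0) (j := 1) (k := 2) _ _)).1 ?_
  refine (comp_ver f _ _).symm.trans (Eq.trans ?_ (comp_ver g _ _))
  exact congrArg (fun x => _ ≫ (comp x (Shape.top 1)).hom) h

theorem hom_eq_of_face_two (hZ : IsZero Z) {A B : S Z 2}
    (hA : IsZero ((diagram A).obj ⟨(1, 2), by decide⟩)) {f g : A ⟶ B}
    (h : (face Z 2).map f = (face Z 2).map g) : f = g := by
  have := isIso_hor_of_isZero hZ A hA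
  refine hom_ext ?_
  refine (cancel_epi (hor (diagram A) (i := 0) (j := 1) (k := 2) _ _)).1 ?_
  refine (comp_hor f _ _).trans (Eq.trans ?_ (comp_hor g _ _).symm)
  exact congrArg (fun x => (comp x (Shape.top 1)).hom ≫ _) h

theorem ver_hom_naturality {A B : S Z 2} (k : A ⟶ B) {f : (face Z 1).obj A ⟶ (face Z 0).obj A}
    {g : (face Z 1).obj B ⟶ (face Z 0).obj B}
    (hf : (comp f (Shape.top 1)).hom =
      ver (diagram A) (i := 0) (j := 1) (k := 2) (by decide) (by decide))
    (hg : (comp g (Shape.top 1)).hom =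
      ver (diagram B) (i := 0) (j := 1) (k := 2) (by decide) (by decide)) :
    (face Z 1).map k ≫ g = f ≫ (face Z 0).map k :=
  hom_ext ((congrArg (_ ≫ ·) hg).trans ((comp_ver k _ _).symm.trans
    (congrArg (· ≫ _) hf.symm)))

theorem hor_hom_naturality {A B : S Z 2} (k : A ⟶ B) {f : (face Z 2).obj A ⟶ (face Z 1).obj A}
    {g : (face Z 2).obj B ⟶ (face Z 1).obj B}
    (hf : (comp f (Shape.top 1)).hom =
      hor (diagram A) (i := 0) (j := 1) (k := 2) (by decide) (by decide))
    (hg : (comp g (Shape.top 1)).hom =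
      hor (diagram B) (i := 0) (j := 1) (k := 2) (by decide) (by decide)) :
    (face Z 2).map k ≫ g = f ≫ (face Z 1).map k :=
  hom_ext ((congrArg (_ ≫ ·) hg).trans ((comp_hor k _ _).symm.trans
    (congrArg (· ≫ _) hf.symm)))

variable [HasZeroMorphisms C]

theorem exists_hom_one (hZ : IsZero Z) {A B : S Z 1}
    (α : (diagram A).obj (Shape.top 1) ≅ (diagram B).obj (Shape.top 1)) :
    ∃ f : A ⟶ B, (comp f (Shape.top 1)).hom = α.hom :=
  exists_hom hZ α
    (fun j => match j with
      | 0 => (isZero_diag A hZ 0).eq_of_src _ _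
      | 1 => (isZero_diag B hZ 1).eq_of_tgt _ _)
    (fun j => match j with
      | 0 => (isZero_diag B hZ 0).eq_of_src _ _
      | 1 => (isZero_diag A hZ 1).eq_of_tgt _ _)

theorem exists_hom_zero (hZ : IsZero Z) (A B : S Z 0) : Nonempty (A ⟶ B) := by
  obtain ⟨f, -⟩ := exists_hom hZ (A := A) (B := B)
    ((isZero_diag A hZ 0).iso (isZero_diag B hZ 0))
    (fun j => match j with
      | 0 => (isZero_diag A hZ 0).eq_of_src _ _)
    (fun j => match j with
      | 0 => (isZero_diag B hZ 0).eq_of_src _ _)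
  exact ⟨f⟩

/-- The total object of a flag of length zero is a zero object, so any two such flags are uniquely
isomorphic; one exists, from the one-term chain `Z`. -/
theorem toPoint_isEquivalence (hC : IsProtoAbelian C) (hZ : IsZero Z) :
    ((Functor.const (S Z 0)).obj SpanGrpd.Point.point.{v, u}).IsEquivalence where
  faithful := ⟨fun {A B f g} _ => hom_eq_of_isZero (isZero_diag A hZ 0) f g⟩
  full := ⟨fun {A B} _ => (exists_hom_zero hZ A B).elim fun f => ⟨f, rfl⟩⟩
  essSurj := ⟨fun x => by
    obtain ⟨A, hA, -⟩ := exists_isFlag_of_chain (n := 0) hC hZ (fun _ => Over.mk (𝟙 Z))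
      (fun _ => inferInstanceAs (Mono (𝟙 Z))) (fun _ _ _ => ⟨𝟙 _⟩) hZ
    cases x
    exact ⟨ofDiagram hA, ⟨Iso.refl _⟩⟩⟩

/-- The groupoid of flags of length zero is equivalent to the terminal groupoid. -/
noncomputable def pointEquiv (hC : IsProtoAbelian C) (hZ : IsZero Z) :
    S Z 0 ≌ SpanGrpd.Point.{v, u} :=
  haveI := toPoint_isEquivalence hC hZ
  ((Functor.const (S Z 0)).obj SpanGrpd.Point.point).asEquivalence

/-- A span whose left leg is an equivalence is the graph of the inverse followed by the right leg.
As a graph, the unit composes with other spans without a further 2-pullback. -/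
theorem fromTensorUnit_eq (hC : IsProtoAbelian C) (hZ : IsZero Z) :
    fromTensorUnit Z = SpanGrpd.graphHom (A := 𝟙_ SpanGrpd.{v, u}) (pointEquiv hC hZ).inverse :=
  Quotient.sound (Setoid.symm ⟨(pointEquiv hC hZ).inverse,
    (pointEquiv hC hZ).isEquivalence_inverse, ⟨(pointEquiv hC hZ).counitIso⟩, ⟨Iso.refl _⟩⟩)

theorem isIso_fromTensorUnit (hC : IsProtoAbelian C) (hZ : IsZero Z) :
    IsIso (fromTensorUnit Z) := by
  rw [fromTensorUnit_eq hC hZ]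
  exact (SpanGrpd.graphIso (A := S Z 0) (B := 𝟙_ SpanGrpd.{v, u}) (pointEquiv hC hZ)).isIso_inv

/-- The functor from the terminal groupoid to `S_1` that represents the unit. -/
noncomputable def unitFunctor (hC : IsProtoAbelian C) (hZ : IsZero Z) :
    SpanGrpd.Point.{v, u} ⥤ S Z 1 :=
  (pointEquiv hC hZ).inverse ⋙ degeneracy Z 0

theorem fromTensorUnit_comp_unit (hC : IsProtoAbelian C) (hZ : IsZero Z) :
    fromTensorUnit Z ≫ unit Z =
      SpanGrpd.graphHom (A := 𝟙_ SpanGrpd.{v, u}) (unitFunctor hC hZ) := by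
  rw [fromTensorUnit_eq hC hZ]
  exact SpanGrpd.graphHom_comp (A := 𝟙_ SpanGrpd.{v, u}) _ _

theorem unitFunctor_isZero (hC : IsProtoAbelian C) (hZ : IsZero Z) (x : SpanGrpd.Point.{v, u}) :
    IsZero ((diagram ((unitFunctor hC hZ).obj x)).obj (Shape.top 1)) :=
  degeneracy_isZero hZ _

/-- The given map on `A_{12}` is transported to `A_{02}` along the invertible quotient maps. -/
theorem exists_face_zero_eq (hZ : IsZero Z) {A B : S Z 2}
    (hA : IsZero ((diagram A).obj ⟨(0, 1), by decide⟩))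
    (hB : IsZero ((diagram B).obj ⟨(0, 1), by decide⟩))
    (h : (face Z 0).obj A ⟶ (face Z 0).obj B) : ∃ f : A ⟶ B, (face Z 0).map f = h := by
  have := isIso_ver_of_isZero hZ A hA
  let a := @asIso _ _ _ _ _ (isIso_ver_of_isZero hZ A hA)
  let b := @asIso _ _ _ _ _ (isIso_ver_of_isZero hZ B hB)
  obtain ⟨h₁, hh⟩ : ∃ h₁ : (diagram A).obj ⟨(1, 2), by decide⟩ ≅
      (diagram B).obj ⟨(1, 2), by decide⟩, h₁ = comp h (Shape.top 1) := ⟨_, rfl⟩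
  obtain ⟨f, hf, -⟩ := exists_hom_two hZ (A := A) (B := B) (a ≪≫ h₁ ≪≫ b.symm) (hA.iso hB)
    (hA.eq_of_src _ _)
  refine ⟨f, hom_ext (Eq.trans ?_ (congrArg Iso.hom hh))⟩
  have e := comp_ver f (i := 0) (j := 1) (k := 2) (by decide) (by decide)
  have e' : (a ≪≫ h₁ ≪≫ b.symm).hom ≫ b.hom = a.hom ≫ h₁.hom := by simp
  exact (cancel_epi (ver (diagram A) (i := 0) (j := 1) (k := 2) _ _)).1
    (e.trans ((congrArg (· ≫ _) hf).trans e'))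

theorem exists_face_two_eq (hZ : IsZero Z) {A B : S Z 2}
    (hA : IsZero ((diagram A).obj ⟨(1, 2), by decide⟩))
    (hB : IsZero ((diagram B).obj ⟨(1, 2), by decide⟩))
    (h : (face Z 2).obj A ⟶ (face Z 2).obj B) : ∃ f : A ⟶ B, (face Z 2).map f = h := by
  let a := @asIso _ _ _ _ _ (isIso_hor_of_isZero hZ A hA)
  let b := @asIso _ _ _ _ _ (isIso_hor_of_isZero hZ B hB)
  obtain ⟨h₁, hh⟩ : ∃ h₁ : (diagram A).obj ⟨(0, 1), by decide⟩ ≅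
      (diagram B).obj ⟨(0, 1), by decide⟩, h₁ = comp h (Shape.top 1) := ⟨_, rfl⟩
  have e : a.hom ≫ (a.symm ≪≫ h₁ ≪≫ b).hom = h₁.hom ≫ b.hom := by simp
  obtain ⟨f, -, hf⟩ := exists_hom_two hZ (A := A) (B := B) (a.symm ≪≫ h₁ ≪≫ b) h₁ e
  exact ⟨f, hom_ext (hf.trans (congrArg Iso.hom hh))⟩

theorem exists_face_zero_obj (hZ : IsZero Z) (B : S Z 1) :
    ∃ A : S Z 2, IsZero ((diagram A).obj ⟨(0, 1), by decide⟩) ∧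
      Nonempty (B ⟶ (face Z 0).obj A) := by
  obtain ⟨f, -⟩ := exists_hom_one hZ (A := B) (B := (face Z 0).obj ((degeneracy Z 0).obj B))
    (Iso.refl _)
  exact ⟨_, degeneracy_isZero_zero hZ B, ⟨f⟩⟩

theorem exists_face_two_obj (hZ : IsZero Z) (B : S Z 1) :
    ∃ A : S Z 2, IsZero ((diagram A).obj ⟨(1, 2), by decide⟩) ∧
      Nonempty (B ⟶ (face Z 2).obj A) := by
  obtain ⟨f, -⟩ := exists_hom_one hZ (A := B) (B := (face Z 2).obj ((degeneracy Z 1).obj B))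
    (Iso.refl _)
  exact ⟨_, degeneracy_isZero_one hZ B, ⟨f⟩⟩

/-- This 2-pullback is the apex of the unit composed with the product. The 2-cell forces `A_{01}` to
be zero, so the flag amounts to `A_{12}`, which is the given object of `S_1`. -/
theorem unitLeft_isEquivalence (hC : IsProtoAbelian C) (hZ : IsZero Z) :
    (CategoricalPullback.π₁ ((unitFunctor hC hZ).prod (𝟭 (S Z 1)))
      (Functor.prod' (face Z (n := 1) 2) (face Z 0))).IsEquivalence := by
  have hz {x : SpanGrpd.Point.{v, u} × S Z 1} {A : S Z 2}
      (i : ((unitFunctor hC hZ).prod (𝟭 (S Z 1))).obj x ≅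
        (Functor.prod' (face Z (n := 1) 2) (face Z 0)).obj A) :
      IsZero ((diagram A).obj ⟨(0, 1), by decide⟩) :=
    isZero_of_hom (p := Shape.top 1) i.hom.1 (unitFunctor_isZero hC hZ x.1)
  refine TwoPullback.isEquivalence_fst _ _ ?_ ?_ ?_
  · rintro ⟨x, B⟩
    obtain ⟨A, hA, ⟨f⟩⟩ := exists_face_zero_obj hZ B
    obtain ⟨g, -⟩ := exists_hom_one hZ (A := (unitFunctor hC hZ).obj x) (B := (face Z 2).obj A)
      ((unitFunctor_isZero hC hZ x).iso hA)
    exact ⟨A, ⟨Iso.prod ((Groupoid.isoEquivHom _ _).symm g) ((Groupoid.isoEquivHom _ _).symm f)⟩⟩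
  · intro x A B i f g h
    exact hom_eq_of_face_zero hZ (isZero_of_hom f (hz i)) (congrArg (fun k => k.2) h)
  · intro x y A B i j k
    obtain ⟨f, hf⟩ := exists_face_zero_eq hZ (hz i) (hz j) (i.inv.2 ≫ k.2 ≫ j.hom.2)
    exact ⟨f, CategoryTheory.Prod.hom_ext (hom_eq_of_isZero (hz i) _ _) hf⟩

theorem unitRight_isEquivalence (hC : IsProtoAbelian C) (hZ : IsZero Z) :
    (CategoricalPullback.π₁ ((𝟭 (S Z 1)).prod (unitFunctor hC hZ))
      (Functor.prod' (face Z (n := 1) 2) (face Z 0))).IsEquivalence := by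
  have hz {x : S Z 1 × SpanGrpd.Point.{v, u}} {A : S Z 2}
      (i : ((𝟭 (S Z 1)).prod (unitFunctor hC hZ)).obj x ≅
        (Functor.prod' (face Z (n := 1) 2) (face Z 0)).obj A) :
      IsZero ((diagram A).obj ⟨(1, 2), by decide⟩) :=
    isZero_of_hom (p := Shape.top 1) i.hom.2 (unitFunctor_isZero hC hZ x.2)
  refine TwoPullback.isEquivalence_fst _ _ ?_ ?_ ?_
  · rintro ⟨B, x⟩
    obtain ⟨A, hA, ⟨f⟩⟩ := exists_face_two_obj hZ B
    obtain ⟨g, -⟩ := exists_hom_one hZ (A := (unitFunctor hC hZ).obj x) (B := (face Z 0).obj A)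
      ((unitFunctor_isZero hC hZ x).iso hA)
    exact ⟨A, ⟨Iso.prod ((Groupoid.isoEquivHom _ _).symm f) ((Groupoid.isoEquivHom _ _).symm g)⟩⟩
  · intro x A B i f g h
    exact hom_eq_of_face_two hZ (hz i) (congrArg (fun k => k.1) h)
  · intro x y A B i j k
    obtain ⟨f, hf⟩ := exists_face_two_eq hZ (hz i) (hz j) (i.inv.1 ≫ k.1 ≫ j.hom.1)
    exact ⟨f, CategoryTheory.Prod.hom_ext hf (hom_eq_of_isZero (hz i) _ _)⟩

theorem exists_ver_hom (hZ : IsZero Z) {A : S Z 2}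
    (hA : IsZero ((diagram A).obj ⟨(0, 1), by decide⟩)) :
    ∃ f : (face Z 1).obj A ⟶ (face Z 0).obj A, (comp f (Shape.top 1)).hom =
      ver (diagram A) (i := 0) (j := 1) (k := 2) (by decide) (by decide) :=
  exists_hom_one hZ (A := (face Z 1).obj A) (B := (face Z 0).obj A)
    (@asIso _ _ _ _ _ (isIso_ver_of_isZero hZ A hA))

theorem exists_hor_hom (hZ : IsZero Z) {A : S Z 2}
    (hA : IsZero ((diagram A).obj ⟨(1, 2), by decide⟩)) :
    ∃ f : (face Z 2).obj A ⟶ (face Z 1).obj A, (comp f (Shape.top 1)).hom =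
      hor (diagram A) (i := 0) (j := 1) (k := 2) (by decide) (by decide) :=
  exists_hom_one hZ (A := (face Z 2).obj A) (B := (face Z 1).obj A)
    (@asIso _ _ _ _ _ (isIso_hor_of_isZero hZ A hA))

theorem unit_mul (hC : IsProtoAbelian C) (hZ : IsZero Z) :
    (fromTensorUnit Z ≫ unit Z) ▷ S Z 1 ≫ mul Z = (λ_ (S Z 1)).hom := by
  rw [fromTensorUnit_comp_unit hC hZ]
  change SpanGrpd.tensor (SpanGrpd.graphHom _) (𝟙 _) ≫ _ = _
  erw [SpanGrpd.tensor_graphHom_id]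
  have hz (x : CategoricalPullback ((unitFunctor hC hZ).prod (𝟭 (S Z 1)))
      (Functor.prod' (face Z (n := 1) 2) (face Z 0))) :
      IsZero ((diagram x.snd).obj ⟨(0, 1), by decide⟩) :=
    isZero_of_hom (p := Shape.top 1) x.iso.hom.1 (unitFunctor_isZero hC hZ x.fst.1)
  -- The 2-cell is `A_{02} ≅ A_{12} ≅ B`. Choosing objectwise does no harm to naturality, because
  -- `hf` prescribes the component on the total object and this determines the morphism.
  choose f hf using fun x => exists_ver_hom hZ (hz x)
  refine Quotient.sound ⟨CategoricalPullback.π₁ ((unitFunctor hC hZ).prod (𝟭 (S Z 1)))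
    (Functor.prod' (face Z (n := 1) 2) (face Z 0)), unitLeft_isEquivalence hC hZ, ⟨Iso.refl _⟩,
    ⟨Iso.symm (NatIso.ofComponents (fun x => (Groupoid.isoEquivHom _ _).symm (f x ≫ x.iso.inv.2))
      ?_)⟩⟩
  intro x y k
  have h1 := ver_hom_naturality k.snd (hf x) (hf y)
  have h2 : (face Z 0).map k.snd ≫ y.iso.inv.2 = x.iso.inv.2 ≫ k.fst.2 :=
    congrArg (fun k => k.2) k.w'
  change (face Z 1).map k.snd ≫ f y ≫ y.iso.inv.2 = (f x ≫ x.iso.inv.2) ≫ k.fst.2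
  refine (Category.assoc _ _ _).symm.trans ((congrArg (· ≫ _) h1).trans ?_)
  exact (Category.assoc _ _ _).trans ((congrArg (_ ≫ ·) h2).trans (Category.assoc _ _ _).symm)

theorem mul_unit (hC : IsProtoAbelian C) (hZ : IsZero Z) :
    S Z 1 ◁ (fromTensorUnit Z ≫ unit Z) ≫ mul Z = (ρ_ (S Z 1)).hom := by
  rw [fromTensorUnit_comp_unit hC hZ]
  change SpanGrpd.tensor (𝟙 _) (SpanGrpd.graphHom _) ≫ _ = _
  erw [SpanGrpd.tensor_id_graphHom]
  have hz (x : CategoricalPullback ((𝟭 (S Z 1)).prod (unitFunctor hC hZ))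
      (Functor.prod' (face Z (n := 1) 2) (face Z 0))) :
      IsZero ((diagram x.snd).obj ⟨(1, 2), by decide⟩) :=
    isZero_of_hom (p := Shape.top 1) x.iso.hom.2 (unitFunctor_isZero hC hZ x.fst.2)
  -- Here the 2-cell is `B ≅ A_{01} ≅ A_{02}`, by the horizontal map.
  choose f hf using fun x => exists_hor_hom hZ (hz x)
  refine Quotient.sound ⟨CategoricalPullback.π₁ ((𝟭 (S Z 1)).prod (unitFunctor hC hZ))
    (Functor.prod' (face Z (n := 1) 2) (face Z 0)), unitRight_isEquivalence hC hZ, ⟨Iso.refl _⟩,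
    ⟨NatIso.ofComponents (fun x => (Groupoid.isoEquivHom _ _).symm (x.iso.hom.1 ≫ f x)) ?_⟩⟩
  intro x y k
  have h1 := hor_hom_naturality k.snd (hf x) (hf y)
  have h2 : k.fst.1 ≫ y.iso.hom.1 = x.iso.hom.1 ≫ (face Z 2).map k.snd :=
    congrArg (fun k => k.1) k.w
  change k.fst.1 ≫ y.iso.hom.1 ≫ f y = (x.iso.hom.1 ≫ f x) ≫ (face Z 1).map k.snd
  refine (Category.assoc _ _ _).symm.trans ((congrArg (· ≫ _) h2).trans ?_)
  exact (Category.assoc _ _ _).trans ((congrArg (_ ≫ ·) h1).trans (Category.assoc _ _ _).symm)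

end

end Flag

theorem mainTheorem2 {C : Type u} [Category.{v} C] (hC : IsProtoAbelian C) (Z : C)
    (hZ : IsZero Z) :
    IsIso (Flag.fromTensorUnit Z) ∧
      ∃ H : MonObj (Flag.S Z 1),
        H.mul = Flag.mul Z ∧ H.one = Flag.fromTensorUnit Z ≫ Flag.unit Z := by
  have := hC.pointed
  -- Zero morphisms are auxiliary: neither flags nor the structure maps refer to them.
  let := HasZeroObject.zeroMorphismsOfZeroObject (C := C)
  exact ⟨Flag.isIso_fromTensorUnit hC hZ,
    { one := Flag.fromTensorUnit Z ≫ Flag.unit Z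
      mul := Flag.mul Z
      one_mul := Flag.unit_mul hC hZ
      mul_one := Flag.mul_unit hC hZ
      mul_assoc := Flag.mul_assoc hC hZ }, rfl, rfl⟩
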